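/- Let $n\ge 1$. Let $p,q:\mathbb{R}^n\to(0,\infty)$ be measurable with $0<\operatorname{ess\,inf}p\le\operatorname{ess\,sup}p<\infty$ and $0<\operatorname{ess\,inf}q\le\operatorname{ess\,sup}q<\infty$, let $s:\mathbb{R}^n\to\mathbb{R}$, and suppose that each $r\in\{p,q,s\}$ is log-Hölder continuous, i.e. there are $C>0$ and $r_\infty\in\mathbb{R}$ with $$|r(x)-r(y)|\le \frac{C}{\log(e+|x-y|^{-1})}\quad(x\ne y),\qquad |r(x)-r_\infty|\le\frac{C}{\log(e+|x|)}\quad(x\in\mathbb{R}^n).$$ Let $\theta=\{\theta_j\}_{j\ge0}\subset\mathcal{S}(\mathbb{R}^n)$ be a smooth dyadic resolution of unity: $\operatorname{supp}\theta_0\subset\{|x|\le2\}$, $\operatorname{supp}\theta_j\subset\{2^{j-1}\le|x|\le2^{j+1}\}$ for $j\ge1$, $\sup_{j,x}2^{j|\alpha|}|D^\alpha\theta_j(x)|<\infty$ for every multi-index $\alpha$, and $\sum_j\theta_j\equiv1$. For $f\in\mathcal{S}'(\mathbb{R}^n)$ put $\theta_j(D)f=\mathcal{F}^{-1}[\theta_j\mathcal{F}f]$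 with $\mathcal{F}h(\xi)=\int e^{-2\pi i x\cdot\xi}h(x)\,dx$; this is a continuous function of polynomial growth. Let $\|g\|_{L^{p(\cdot)}}=\inf\{\lambda>0:\int(|g(x)|/\lambda)^{p(x)}dx\le1\}$, $$\|\{g_j\}\|_{L^{p(\cdot)}(\ell^{q(\cdot)})}=\Big\|\Big(\sum_{j\ge0}|g_j(\cdot)|^{q(\cdot)}\Big)^{1/q(\cdot)}\Big\|_{L^{p(\cdot)}},\qquad \|\{g_j\}\|_{\ell^{q(\cdot)}(L^{p(\cdot)})}=\inf\{\mu>0:\varrho(\{g_j/\mu\})\le1\},$$ $$\varrho(\{g_j\})=\sum_{j\ge0}\inf\Big\{\lambda>0:\int_{\mathbb{R}^n}\Big(\frac{|g_j(x)|}{\lambda^{1/q(x)}}\Big)^{p(x)}dx\le1\Big\}.$$ The spaces $B^{s(\cdot)}_{p(\cdot),q(\cdot)}(\mathbb{R}^n)$ and $F^{s(\cdot)}_{p(\cdot),q(\cdot)}(\mathbb{R}^n)$ consist of the $f\in\mathcal{S}'(\mathbb{R}^n)$ for which the $\ell^{q(\cdot)}(L^{p(\cdot)})$, respectively $L^{p(\cdot)}(\ell^{q(\cdot)})$,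 quasi-norm of $\{2^{js(\cdot)}\theta_j(D)f\}_{j\ge0}$ is finite, and this is the quasi-norm of $f$. Let $A^{s(\cdot)}_{p(\cdot),q(\cdot)}(\mathbb{R}^n)$ be either of them. For $a:\mathbb{R}^n\to\mathbb{R}$ let $B^{a(\cdot)}_{\infty,\infty}$ and $B^{a(\cdot)}_{\infty,1}$ be defined by the norms $\sup_j\|2^{ja(\cdot)}\theta_j(D)f\|_{L^\infty}$ and $\sum_j\|2^{ja(\cdot)}\theta_j(D)f\|_{L^\infty}$, and let $\mathrm{BUC}$ be the space of bounded uniformly continuous functions $\mathbb{R}^n\to\mathbb{C}$ with the supremum norm. An embedding $X\hookrightarrow Y$ means that $X\subset Y$ (a function in $\mathrm{BUC}$ being identified with the tempered distribution it defines) and $\|f\|_Y\le C\|f\|_X$ for all $f\in X$, with $C$ independent of $f$. (1) (Sobolev embedding) $A^{s(\cdot)}_{p(\cdot),q(\cdot)}(\mathbb{R}^n)\hookrightarrow B^{s(\cdot)-n/p(\cdot)}_{\infty,\infty}(\mathbb{R}^n)$. (2) If $\operatorname{ess\,sup}_{x\in\mathbb{R}^n}\big(\frac{n}{p(x)}-s(x)\big)<0$,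 then $A^{s(\cdot)}_{p(\cdot),q(\cdot)}(\mathbb{R}^n)\hookrightarrow B^0_{\infty,1}(\mathbb{R}^n)\hookrightarrow\mathrm{BUC}$; in particular $A^{s(\cdot)}_{p(\cdot),q(\cdot)}(\mathbb{R}^n)\hookrightarrow\mathrm{BUC}$. -/

import Mathlib

open MeasureTheory
open scoped ENNReal NNReal SchwartzMap BoundedContinuousFunction

noncomputable section

namespace VarExp

/-- The Euclidean space `ℝⁿ`. -/
abbrev Rn (n : ℕ) : Type := EuclideanSpace ℝ (Fin n)

variable {n : ℕ}

/-- The class `𝒫₀(ℝⁿ)`: measurable exponents `p : ℝⁿ → (0, ∞)` with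
`0 < ess inf p` and `ess sup p < ∞`. -/
structure IsExponent (p : Rn n → ℝ) : Prop where
  measurable : Measurable p
  pos : ∀ x, 0 < p x
  ess_lower : ∃ c : ℝ, 0 < c ∧ ∀ᵐ x ∂volume, c ≤ p x
  ess_upper : ∃ c : ℝ, ∀ᵐ x ∂volume, p x ≤ c

/-- The class `C^log(ℝⁿ)`: the local log-Hölder condition and the log-decay condition at
infinity. -/
structure IsLogHolder (p : Rn n → ℝ) : Prop where
  holder : ∃ C : ℝ, 0 < C ∧ ∀ x y, x ≠ y →
    |p x - p y| ≤ C / Real.log (Real.exp 1 + ‖x - y‖⁻¹)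
  decay : ∃ C pInf : ℝ, 0 < C ∧ ∀ x,
    |p x - pInf| ≤ C / Real.log (Real.exp 1 + ‖x‖)

/-- The class `Φ(ℝⁿ)` of smooth dyadic resolutions of unity. The bounds on all the partial
derivatives of order `k` are stated for the `k`-th Fréchet derivative. -/
structure IsResolution (θ : ℕ → 𝓢(Rn n, ℂ)) : Prop where
  supp_zero : tsupport (θ 0 : Rn n → ℂ) ⊆ {x | ‖x‖ ≤ 2}
  supp_succ : ∀ j : ℕ, 1 ≤ j →
    tsupport (θ j : Rn n → ℂ) ⊆ {x | (2 : ℝ) ^ ((j : ℤ) - 1) ≤ ‖x‖ ∧ ‖x‖ ≤ (2 : ℝ) ^ (j + 1)}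
  deriv_bound : ∀ k : ℕ, ∃ c : ℝ, 0 < c ∧ ∀ (j : ℕ) (x : Rn n),
    (2 : ℝ) ^ (j * k) * ‖iteratedFDeriv ℝ k (θ j : Rn n → ℂ) x‖ ≤ c
  hasSum_one : ∀ x, HasSum (fun j => θ j x) 1

/-- The Luxemburg quasi-norm `‖F‖_{L^{p(·)}} = inf {λ > 0 : ∫ (F(x)/λ)^{p(x)} dx ≤ 1}` of a
nonnegative function; it is `∞` when no such `λ` exists. -/
def luxNorm (p : Rn n → ℝ) (F : Rn n → ℝ≥0∞) : ℝ≥0∞ :=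
  ⨅ (l : ℝ≥0) (_ : 0 < l) (_ : ∫⁻ x, (F x / (l : ℝ≥0∞)) ^ p x ≤ 1), (l : ℝ≥0∞)

/-- The modular
`ϱ(F) = ∑_j inf {λ_j > 0 : ∫ (F_j(x) / λ_j^{1/q(x)})^{p(x)} dx ≤ 1}` of `ℓ^{q(·)}(L^{p(·)})`. -/
def mixedModular (p q : Rn n → ℝ) (F : ℕ → Rn n → ℝ≥0∞) : ℝ≥0∞ :=
  ∑' j, ⨅ (l : ℝ≥0) (_ : 0 < l)
    (_ : ∫⁻ x, (F j x / (l : ℝ≥0∞) ^ (1 / q x)) ^ p x ≤ 1), (l : ℝ≥0∞)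

/-- The quasi-norm of `ℓ^{q(·)}(L^{p(·)})`. -/
def seqLpNorm (p q : Rn n → ℝ) (F : ℕ → Rn n → ℝ≥0∞) : ℝ≥0∞ :=
  ⨅ (m : ℝ≥0) (_ : 0 < m)
    (_ : mixedModular p q (fun j x => F j x / (m : ℝ≥0∞)) ≤ 1), (m : ℝ≥0∞)

/-- The quasi-norm of `L^{p(·)}(ℓ^{q(·)})`. -/
def lpSeqNorm (p q : Rn n → ℝ) (F : ℕ → Rn n → ℝ≥0∞) : ℝ≥0∞ :=
  luxNorm p (fun x => (∑' j, F j x ^ q x) ^ (1 / q x))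

/-- The norm of `ℓ^1(L^∞)`. -/
def seqNormOneInfty (F : ℕ → Rn n → ℝ≥0∞) : ℝ≥0∞ := ∑' j, essSup (F j) volume

/-- The norm of `ℓ^∞(L^∞)`. -/
def seqNormInftyInfty (F : ℕ → Rn n → ℝ≥0∞) : ℝ≥0∞ := ⨆ j, essSup (F j) volume

/-- The tempered distribution `u` is (integration against) the continuous function `g` of
polynomial growth. Such a `g` is determined by `u`. -/
structure IsFunction (u : 𝓢'(Rn n, ℂ)) (g : Rn n → ℂ) : Prop where
  continuous : Continuous g
  growth : ∃ (C : ℝ) (k : ℕ), ∀ x, ‖g x‖ ≤ C * (1 + ‖x‖) ^ k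
  eq_integral : ∀ φ : 𝓢(Rn n, ℂ), u φ = ∫ x, φ x * g x

/-- `θ_j(D) f = 𝓕⁻¹[θ_j · 𝓕 f]`, where `𝓕 h(ξ) = ∫ e^{-2πi x·ξ} h(x) dx`. -/
def block (θ : ℕ → 𝓢(Rn n, ℂ)) (j : ℕ) (f : 𝓢'(Rn n, ℂ)) : 𝓢'(Rn n, ℂ) :=
  TemperedDistribution.fourierMultiplierCLM ℂ (θ j : Rn n → ℂ) f

/-- The quasi-norm `N` of the sequence of functions `|2^{j a(x)} (θ_j(D) f)(x)|`. Every
`θ_j(D) f` is a tempered distribution with compactly supported Fourier transform, hence (by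
the Paley-Wiener-Schwartz theorem) it is exactly one continuous function `g j` of polynomial
growth, so that the infimum runs over a single sequence `g`. -/
def blockNorm (N : (ℕ → Rn n → ℝ≥0∞) → ℝ≥0∞) (θ : ℕ → 𝓢(Rn n, ℂ)) (a : Rn n → ℝ)
    (f : 𝓢'(Rn n, ℂ)) : ℝ≥0∞ :=
  ⨅ (g : ℕ → Rn n → ℂ) (_ : ∀ j, IsFunction (block θ j f) (g j)),
    N (fun j x => ENNReal.ofReal ((2 : ℝ) ^ ((j : ℝ) * a x)) * ‖g j x‖ₑ)

/-- The quasi-norm of `B^{s(·)}_{p(·),q(·)}(ℝⁿ)`; the space is where it is finite. -/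
def besovNorm (θ : ℕ → 𝓢(Rn n, ℂ)) (s p q : Rn n → ℝ) : 𝓢'(Rn n, ℂ) → ℝ≥0∞ :=
  blockNorm (seqLpNorm p q) θ s

/-- The quasi-norm of `F^{s(·)}_{p(·),q(·)}(ℝⁿ)`; the space is where it is finite. -/
def triebelLizorkinNorm (θ : ℕ → 𝓢(Rn n, ℂ)) (s p q : Rn n → ℝ) : 𝓢'(Rn n, ℂ) → ℝ≥0∞ :=
  blockNorm (lpSeqNorm p q) θ s

/-- The norm of `B^{a(·)}_{∞,∞}(ℝⁿ)`. -/
def besovInftyInftyNorm (θ : ℕ → 𝓢(Rn n, ℂ)) (a : Rn n → ℝ) : 𝓢'(Rn n, ℂ) → ℝ≥0∞ :=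
  blockNorm seqNormInftyInfty θ a

/-- The norm of `B^{a(·)}_{∞,1}(ℝⁿ)`. -/
def besovInftyOneNorm (θ : ℕ → 𝓢(Rn n, ℂ)) (a : Rn n → ℝ) : 𝓢'(Rn n, ℂ) → ℝ≥0∞ :=
  blockNorm seqNormOneInfty θ a

/-- Continuous embedding of `{f ∈ 𝓢' : N₁ f < ∞}` into `{f ∈ 𝓢' : N₂ f < ∞}`. -/
def Embeds (N₁ N₂ : 𝓢'(Rn n, ℂ) → ℝ≥0∞) : Prop :=
  ∃ C : ℝ≥0, ∀ f, N₁ f < ∞ → N₂ f ≤ C * N₁ f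

/-- Continuous embedding of `{f ∈ 𝓢' : N f < ∞}` into the space `BUC(ℝⁿ)` of bounded uniformly
continuous functions with the supremum norm. -/
def EmbedsIntoBUC (N : 𝓢'(Rn n, ℂ) → ℝ≥0∞) : Prop :=
  ∃ C : ℝ≥0, ∀ f, N f < ∞ →
    ∃ g : Rn n →ᵇ ℂ, UniformContinuous g ∧ IsFunction f g ∧ ‖g‖ₑ ≤ C * N f

end VarExp

end

/-!
The Littlewood–Paley blocks `g j = θ_j(D) f` have Fourier transforms supported in balls of radius
`2^(j+1)`, so they are reproduced by convolution with `2^{jn} η(2^j ·)` for a fixed Schwartz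
function `η` (`IsResolution.block_ae_eq`). Everything rests on the inequality
`2^{j(s(x) - n/p(x))} |g j x| ≤ B l`, valid as soon as `∫ (2^{js} |g j| / l)^p ≤ 1`, with `B`
independent of `j` (`exists_pointwise_bound`).

Put `a = s - n/p` and `K = 2^{ja} |g j| / l`. The exponent `a` is locally log-Hölder continuous, so
that the weight `2^{ja}` varies at most polynomially at the scale `2⁻ʲ`
(`LocLogHolder.exists_weight_le`). Hence `K` is dominated by its averages against a kernel
`2^{jn} k(2^j ·)` with `k` bounded and integrable, while the normalization becomes
`∫ 2^{jn} K^p ≤ 1`. If `r ≤ min(1, ess inf p)`, then `K ≤ (sup K)^{1-r} (1 + K^p)`, and inserting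
this into the average gives `sup K ≤ C (sup K)^{1-r}`, that is, `K ≤ C^{1/r}` (`le_of_le_average`).
This needs `sup K < ∞`, which follows from the same argument applied to `K` damped by a negative
power of `1 + |· - x₀|` that compensates the polynomial growth of `g j`. Working with modulars in
this way, one needs neither maximal functions nor the behaviour of the exponents at infinity.

The quasi-norms of `ℓ^{q(·)}(L^{p(·)})` and `L^{p(·)}(ℓ^{q(·)})` both control the modulars of the
individual members of a sequence (`ControlsModulars`), which gives the embeddings into
`B^{s - n/p}_{∞,∞}`, and, by summing a geometric series when `s - n/p ≥ ε > 0`, into `B^0_{∞,1}`.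

A distribution in `B^0_{∞,1}` is the sum of its blocks, since `∑ θ_j φ` converges to `φ` in the
Schwartz space (`IsResolution.tendsto_sum_smul`); the blocks are bounded and, by the reproducing
formula, uniformly continuous, and their sum converges uniformly.
-/

namespace VarExp

open Filter Topology FourierTransform
open scoped RealInnerProductSpace

variable {n : ℕ}

/-! ### Log-Hölder weights -/

/-- The local log-Hölder condition with constant `C`. -/
def LocLogHolder (C : ℝ) (a : Rn n → ℝ) : Prop :=
  ∀ x y, x ≠ y → |a x - a y| ≤ C / Real.log (Real.exp 1 + ‖x - y‖⁻¹)

lemma one_le_log_exp_one_add {t : ℝ} (ht : 0 ≤ t) : 1 ≤ Real.log (Real.exp 1 + t) := by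
  rw [Real.le_log_iff_exp_le (by positivity)]
  linarith

lemma LocLogHolder.continuous {C : ℝ} {a : Rn n → ℝ} (h : LocLogHolder C a) :
    Continuous a := by
  rw [continuous_iff_continuousAt]
  intro x
  rw [continuousAt_iff_punctured_nhds, tendsto_iff_norm_sub_tendsto_zero]
  have hnorm : Tendsto (fun y => ‖y - x‖) (𝓝[≠] x) (𝓝[>] 0) := by
    refine tendsto_nhdsWithin_iff.2 ⟨?_, ?_⟩
    · have : Continuous fun y : Rn n => ‖y - x‖ := by fun_prop
      simpa using (this.tendsto x).mono_left nhdsWithin_le_nhds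
    · filter_upwards [self_mem_nhdsWithin] with y hy
      exact norm_pos_iff.2 (sub_ne_zero.2 hy)
  have hlog : Tendsto (fun y => C / Real.log (Real.exp 1 + ‖y - x‖⁻¹)) (𝓝[≠] x) (𝓝 0) :=
    (Real.tendsto_log_atTop.comp (tendsto_atTop_add_const_left _ _
      (tendsto_inv_nhdsGT_zero.comp hnorm))).const_div_atTop C
  refine squeeze_zero' (Eventually.of_forall fun _ => norm_nonneg _) ?_ hlog
  filter_upwards [self_mem_nhdsWithin] with y hy
  exact h y x hy

/-- The weight `x ↦ 2 ^ (j a(x))` varies at most polynomially at the scale `2⁻ʲ`, uniformly in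
`j`: this is what the local log-Hölder condition is for. -/
lemma LocLogHolder.exists_weight_le {C : ℝ} {a : Rn n → ℝ} (h : LocLogHolder C a) (hC : 0 ≤ C) :
    ∃ (A : ℝ) (M : ℕ), 1 ≤ A ∧ ∀ (j : ℕ) (x y : Rn n),
      (2 : ℝ) ^ ((j : ℝ) * a x) ≤
        A * (1 + (2 : ℝ) ^ j * ‖x - y‖) ^ M * (2 : ℝ) ^ ((j : ℝ) * a y) := by
  refine ⟨Real.exp (2 * C), ⌈2 * C⌉₊, Real.one_le_exp (by positivity), fun j x y => ?_⟩
  suffices hs : (2 : ℝ) ^ ((j : ℝ) * (a x - a y)) ≤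
      Real.exp (2 * C) * (1 + (2 : ℝ) ^ j * ‖x - y‖) ^ ⌈2 * C⌉₊ by
    have h2 : (2 : ℝ) ^ ((j : ℝ) * a x) =
        (2 : ℝ) ^ ((j : ℝ) * (a x - a y)) * (2 : ℝ) ^ ((j : ℝ) * a y) := by
      rw [← Real.rpow_add two_pos]; ring_nf
    rw [h2]
    gcongr
  have hone : (1 : ℝ) ≤ 1 + (2 : ℝ) ^ j * ‖x - y‖ := by
    have : (0 : ℝ) ≤ (2 : ℝ) ^ j * ‖x - y‖ := by positivity
    linarith
  rcases eq_or_ne x y with rfl | hxy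
  · simpa using (Real.one_le_exp (by positivity : (0:ℝ) ≤ 2 * C))
  have ht : 0 < ‖x - y‖ := norm_pos_iff.2 (sub_ne_zero.2 hxy)
  have hlog1 := one_le_log_exp_one_add (inv_nonneg.2 ht.le)
  have hd := (le_abs_self _).trans (h x y hxy)
  -- the two regimes are separated at the distance `2 ^ (-j / 2)`
  rcases le_total ((2 : ℝ) ^ ((j : ℝ) / 2)) (1 + (2 : ℝ) ^ j * ‖x - y‖) with hbig | hsmall
  · have hdC : a x - a y ≤ C := hd.trans (div_le_self hC hlog1)
    calc (2 : ℝ) ^ ((j : ℝ) * (a x - a y)) ≤ (2 : ℝ) ^ ((j : ℝ) / 2 * (2 * C)) := by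
          apply Real.rpow_le_rpow_of_exponent_le one_le_two
          nlinarith [(Nat.cast_nonneg j : (0 : ℝ) ≤ j)]
      _ = ((2 : ℝ) ^ ((j : ℝ) / 2)) ^ (2 * C) := Real.rpow_mul zero_le_two _ _
      _ ≤ (1 + (2 : ℝ) ^ j * ‖x - y‖) ^ (2 * C) := by gcongr
      _ ≤ (1 + (2 : ℝ) ^ j * ‖x - y‖) ^ (⌈2 * C⌉₊ : ℝ) :=
          Real.rpow_le_rpow_of_exponent_le hone (Nat.le_ceil _)
      _ = (1 + (2 : ℝ) ^ j * ‖x - y‖) ^ ⌈2 * C⌉₊ := Real.rpow_natCast _ _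
      _ ≤ _ := le_mul_of_one_le_left (by positivity) (Real.one_le_exp (by positivity))
  · have hlt : (2 : ℝ) ^ ((j : ℝ) / 2) ≤ ‖x - y‖⁻¹ := by
      have h3 : (2 : ℝ) ^ j * ‖x - y‖ ≤ (2 : ℝ) ^ ((j : ℝ) / 2) := by linarith
      have h4 : (2 : ℝ) ^ j = (2 : ℝ) ^ ((j : ℝ) / 2) * (2 : ℝ) ^ ((j : ℝ) / 2) := by
        rw [← Real.rpow_add two_pos, add_halves, Real.rpow_natCast]
      rw [h4, mul_assoc] at h3
      have h5 : (2 : ℝ) ^ ((j : ℝ) / 2) * ‖x - y‖ ≤ 1 :=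
        le_of_mul_le_mul_left (by simpa using h3) (by positivity)
      rw [← one_div, le_div_iff₀ ht]
      exact h5
    have hlog2 : (j : ℝ) / 2 * Real.log 2 ≤ Real.log (Real.exp 1 + ‖x - y‖⁻¹) := by
      rw [← Real.log_rpow two_pos]
      exact Real.log_le_log (by positivity) (hlt.trans (by linarith [Real.exp_pos 1]))
    have hmain : Real.log 2 * ((j : ℝ) * (a x - a y)) ≤ 2 * C := by
      have hl : 0 ≤ Real.log 2 * j := by positivity
      calc Real.log 2 * ((j : ℝ) * (a x - a y))
          = (Real.log 2 * j) * (a x - a y) := by ring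
        _ ≤ (Real.log 2 * j) * (C / Real.log (Real.exp 1 + ‖x - y‖⁻¹)) := by gcongr
        _ = (Real.log 2 * j * C) / Real.log (Real.exp 1 + ‖x - y‖⁻¹) := by ring
        _ ≤ 2 * C := by
          rw [div_le_iff₀ (by linarith)]
          nlinarith
    calc (2 : ℝ) ^ ((j : ℝ) * (a x - a y)) = Real.exp (Real.log 2 * ((j : ℝ) * (a x - a y))) :=
          Real.rpow_def_of_pos two_pos _
      _ ≤ Real.exp (2 * C) := Real.exp_le_exp.2 hmain
      _ ≤ _ := le_mul_of_one_le_right (by positivity) (one_le_pow₀ hone)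

lemma le_of_ae_le_of_continuous {α : Type*} [TopologicalSpace α] [LinearOrder α]
    [OrderClosedTopology α] {f g : Rn n → α} (hf : Continuous f) (hg : Continuous g)
    (h : ∀ᵐ x ∂volume, f x ≤ g x) (x : Rn n) : f x ≤ g x := by
  have hopen : IsOpen {x | g x < f x} := isOpen_lt hg hf
  have h0 : volume {x | g x < f x} = 0 := by
    simpa [ae_iff] using h
  rw [hopen.measure_eq_zero_iff volume] at h0
  by_contra hx
  exact (h0 ▸ (not_le.1 hx : x ∈ {x | g x < f x}) : x ∈ (∅ : Set (Rn n)))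

lemma IsLogHolder.locLogHolder {a : Rn n → ℝ} (h : IsLogHolder a) :
    ∃ C, 0 ≤ C ∧ LocLogHolder C a :=
  let ⟨C, hC, h⟩ := h.holder
  ⟨C, hC.le, h⟩

/-- The exponent `s - n / p` of the Sobolev embedding inherits the local log-Hölder condition. -/
lemma exists_locLogHolder_sub_div {p s : Rn n → ℝ} (hp : IsExponent p) (hpl : IsLogHolder p)
    (hs : IsLogHolder s) :
    ∃ C, 0 ≤ C ∧ LocLogHolder C (fun x => s x - n / p x) := by
  obtain ⟨C₁, hC₁, h₁⟩ := hpl.locLogHolder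
  obtain ⟨C₂, hC₂, h₂⟩ := hs.locLogHolder
  obtain ⟨c, hc, hcp⟩ := hp.ess_lower
  have hcp' : ∀ x, c ≤ p x := le_of_ae_le_of_continuous continuous_const h₁.continuous hcp
  refine ⟨C₂ + n * C₁ / c ^ 2, by positivity, fun x y hxy => ?_⟩
  have hx := hc.trans_le (hcp' x)
  have hy := hc.trans_le (hcp' y)
  have hL := one_le_log_exp_one_add (inv_nonneg.2 (norm_nonneg (x - y)))
  set L := Real.log (Real.exp 1 + ‖x - y‖⁻¹)
  have e1 : s x - n / p x - (s y - n / p y) = (s x - s y) + n * (p x - p y) / (p x * p y) := by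
    field_simp
    ring
  rw [e1]
  have e2 : |(n : ℝ) * (p x - p y) / (p x * p y)| ≤ n * (C₁ / L) / c ^ 2 := by
    rw [abs_div, abs_mul, Nat.abs_cast, abs_of_pos (mul_pos hx hy), sq]
    gcongr
    · exact h₁ x y hxy
    · exact hcp' x
    · exact hcp' y
  calc _ ≤ |s x - s y| + |(n : ℝ) * (p x - p y) / (p x * p y)| := abs_add_le _ _
    _ ≤ C₂ / L + n * (C₁ / L) / c ^ 2 := add_le_add (h₂ x y hxy) e2
    _ = _ := by ring

/-! ### A bootstrap estimate for functions dominated by their averages -/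

lemma le_rpow_mul_one_add_rpow {r t : ℝ} (hr0 : 0 < r) (hr1 : r ≤ 1) (hrt : r ≤ t) {K S : ℝ≥0∞}
    (hK : K ≤ S) : K ≤ S ^ (1 - r) * (1 + K ^ t) := by
  have h1 : K ^ r ≤ 1 + K ^ t := by
    rcases le_total K 1 with h | h
    · exact (ENNReal.rpow_le_one h hr0.le).trans le_self_add
    · exact (ENNReal.rpow_le_rpow_of_exponent_le h hrt).trans le_add_self
  calc K = K ^ (1 - r) * K ^ r := by
        rw [← ENNReal.rpow_add_of_nonneg _ _ (by linarith) hr0.le]; simp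
    _ ≤ _ := mul_le_mul' (ENNReal.rpow_le_rpow hK (by linarith)) h1

/-- A bounded function dominated by its averages against a kernel is bounded by a constant that
depends only on the kernel and on the modular of the function. For exponents below `1` the reason
is that `K ≤ (sup K) ^ (1 - r) * K ^ r`, so that a power of `sup K` can be absorbed. -/
lemma le_of_le_average {p : Rn n → ℝ} {r : ℝ} (hr0 : 0 < r) (hr1 : r ≤ 1)
    (hrp : ∀ᵐ y ∂volume, r ≤ p y) {K : Rn n → ℝ≥0∞} (hKc : Continuous K)
    {κ : Rn n → Rn n → ℝ≥0∞} (hκm : ∀ x, Measurable (κ x)) {T N : ℝ≥0∞}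
    (hκ1 : ∀ x, ∫⁻ y, κ x y ≤ T) (hκs : ∀ x y, κ x y ≤ T * N)
    {S₀ : ℝ≥0∞} (hS₀ : S₀ ≠ ∞) (hK : ∀ x, K x ≤ S₀)
    (hrep : ∀ᵐ x ∂volume, K x ≤ ∫⁻ y, κ x y * K y)
    (hT : T ≠ ∞)
    (hmod : ∫⁻ y, N * K y ^ p y ≤ 1) (x : Rn n) : K x ≤ (2 * T) ^ (1 / r) := by
  set S := ⨆ x, K x with hS
  have hKS : ∀ x, K x ≤ S := le_iSup K
  have hStop : S ≠ ∞ := ((iSup_le hK).trans_lt hS₀.lt_top).ne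
  have key : ∀ x, ∫⁻ y, κ x y * K y ≤ S ^ (1 - r) * (2 * T) := by
    intro x
    calc ∫⁻ y, κ x y * K y
        ≤ ∫⁻ y, S ^ (1 - r) * (κ x y + T * (N * K y ^ p y)) := by
          apply lintegral_mono_ae
          filter_upwards [hrp] with y hy
          calc κ x y * K y ≤ κ x y * (S ^ (1 - r) * (1 + K y ^ p y)) := by
                gcongr; exact le_rpow_mul_one_add_rpow hr0 hr1 hy (hKS y)
            _ = S ^ (1 - r) * (κ x y + κ x y * K y ^ p y) := by ring
            _ ≤ S ^ (1 - r) * (κ x y + (T * N) * K y ^ p y) := by gcongr; exact hκs x y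
            _ = _ := by ring
      _ = S ^ (1 - r) * ((∫⁻ y, κ x y) + T * ∫⁻ y, N * K y ^ p y) := by
          rw [lintegral_const_mul' _ _ (ENNReal.rpow_ne_top_of_nonneg (by linarith) hStop),
            lintegral_add_left (hκm x), lintegral_const_mul' _ _ hT]
      _ ≤ S ^ (1 - r) * (T + T * 1) := by gcongr; exact hκ1 x
      _ = _ := by ring
  have hall : ∀ x, K x ≤ S ^ (1 - r) * (2 * T) :=
    le_of_ae_le_of_continuous hKc continuous_const (hrep.mono fun x hx => hx.trans (key x))
  have hSle : S ≤ S ^ (1 - r) * (2 * T) := iSup_le hall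
  rcases eq_or_ne S 0 with h0 | h0
  · exact (hKS x).trans (by simp [h0])
  have hSr : S ^ r ≤ 2 * T := by
    have h1 : S = S ^ (1 - r) * S ^ r := by
      rw [← ENNReal.rpow_add _ _ h0 hStop]; simp
    have h2 : S ^ (1 - r) * S ^ r ≤ S ^ (1 - r) * (2 * T) := h1 ▸ hSle
    refine (ENNReal.mul_le_mul_iff_right ?_ ?_).1 h2
    · simp [ENNReal.rpow_eq_zero_iff, h0, hStop]
    · exact ENNReal.rpow_ne_top_of_nonneg (by linarith) hStop
  calc K x ≤ S := hKS x
    _ = (S ^ r) ^ (1 / r) := by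
      rw [← ENNReal.rpow_mul, mul_one_div_cancel hr0.ne', ENNReal.rpow_one]
    _ ≤ _ := ENNReal.rpow_le_rpow hSr (by positivity)

/-! ### Dilated Schwartz kernels -/

lemma lintegral_comp_two_pow_smul (f : Rn n → ℝ≥0∞) (hf : Measurable f) (j : ℕ) :
    ENNReal.ofReal (((2 : ℝ) ^ j) ^ n) * ∫⁻ y, f ((2 : ℝ) ^ j • y) = ∫⁻ y, f y := by
  have h2 : ((2 : ℝ) ^ j) ≠ 0 := by positivity
  have h := Measure.map_addHaar_smul (volume : Measure (Rn n)) h2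
  have h' : ∫⁻ y, f ((2 : ℝ) ^ j • y) = ∫⁻ y, f y ∂(Measure.map ((2 : ℝ) ^ j • ·) volume) :=
    (lintegral_map hf (measurable_const_smul _)).symm
  rw [h', h, lintegral_smul_measure, finrank_euclideanSpace_fin, smul_eq_mul, ← mul_assoc,
    ← ENNReal.ofReal_mul (by positivity), abs_of_pos (by positivity),
    mul_inv_cancel₀ (by positivity), ENNReal.ofReal_one, one_mul]

lemma lintegral_comp_two_pow_smul_sub (f : Rn n → ℝ≥0∞) (hf : Measurable f) (j : ℕ) (x : Rn n) :
    ∫⁻ y, ENNReal.ofReal (((2 : ℝ) ^ j) ^ n) * f ((2 : ℝ) ^ j • (y - x)) = ∫⁻ y, f y := by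
  rw [lintegral_const_mul' _ _ ENNReal.ofReal_ne_top,
    lintegral_sub_right_eq_self (fun y => f ((2 : ℝ) ^ j • y)) x,
    lintegral_comp_two_pow_smul f hf]

lemma exists_one_add_pow_mul_norm_le (η : 𝓢(Rn n, ℂ)) (M : ℕ) :
    ∃ B : ℝ, 0 ≤ B ∧ ∀ z, (1 + ‖z‖) ^ M * ‖η z‖ ≤ B := by
  refine ⟨2 ^ M * (Finset.Iic (M, 0)).sup (fun m => SchwartzMap.seminorm ℝ m.1 m.2) η,
    by positivity, fun z => ?_⟩
  simpa using SchwartzMap.one_add_le_sup_seminorm_apply (𝕜 := ℝ) (m := (M, 0)) (k := M) (n := 0)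
    le_rfl le_rfl η z

/-- The supremum and the integral of a Schwartz function with a polynomial weight are finite. -/
lemma exists_weighted_bound (η : 𝓢(Rn n, ℂ)) (M : ℕ) (A : ℝ) :
    ∃ T : ℝ≥0∞, T ≠ ∞ ∧ (∀ z, ENNReal.ofReal (A * (1 + ‖z‖) ^ M * ‖η z‖) ≤ T) ∧
      ∫⁻ z, ENNReal.ofReal (A * (1 + ‖z‖) ^ M * ‖η z‖) ≤ T := by
  obtain ⟨B, hB, h⟩ := exists_one_add_pow_mul_norm_le η (M + (n + 1))
  have hle : ∀ z : Rn n, A * (1 + ‖z‖) ^ M * ‖η z‖ ≤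
      (|A| * B) * (1 + ‖z‖) ^ (-((n : ℝ) + 1)) := by
    intro z
    have hz : 0 < 1 + ‖z‖ := by positivity
    have h1 := h z
    rw [pow_add, mul_right_comm, ← le_div_iff₀ (by positivity)] at h1
    rw [Real.rpow_neg hz.le, ← Nat.cast_add_one, Real.rpow_natCast]
    calc A * (1 + ‖z‖) ^ M * ‖η z‖ ≤ |A| * ((1 + ‖z‖) ^ M * ‖η z‖) := by
          rw [mul_assoc]; gcongr; exact le_abs_self A
      _ ≤ |A| * (B / (1 + ‖z‖) ^ (n + 1)) := by gcongr
      _ = _ := by rw [div_eq_mul_inv, mul_assoc]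
  have hfin : ∫⁻ z : Rn n, ENNReal.ofReal ((1 + ‖z‖) ^ (-((n : ℝ) + 1))) < ∞ :=
    finite_integral_one_add_norm (by simp)
  refine ⟨ENNReal.ofReal (|A| * B) + ENNReal.ofReal (|A| * B) *
    ∫⁻ z : Rn n, ENNReal.ofReal ((1 + ‖z‖) ^ (-((n : ℝ) + 1))), ?_, fun z => ?_, ?_⟩
  · exact ENNReal.add_ne_top.2 ⟨ENNReal.ofReal_ne_top,
      ENNReal.mul_ne_top ENNReal.ofReal_ne_top hfin.ne⟩
  · refine le_trans (ENNReal.ofReal_le_ofReal ((hle z).trans ?_)) le_self_add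
    exact mul_le_of_le_one_right (by positivity) (Real.rpow_le_one_of_one_le_of_nonpos
      (by linarith [norm_nonneg z]) (by linarith [(Nat.cast_nonneg n : (0:ℝ) ≤ n)]))
  · refine le_trans ?_ le_add_self
    rw [← lintegral_const_mul' _ _ ENNReal.ofReal_ne_top]
    refine lintegral_mono fun z => ?_
    rw [← ENNReal.ofReal_mul (by positivity)]
    exact ENNReal.ofReal_le_ofReal (hle z)

/-- `|g|` is dominated by the convolution of `|g|` with the reflection of the dilated kernel
`2^{jn} |η(2^j ·)|`. -/
def DominatedByAverage (η : 𝓢(Rn n, ℂ)) (j : ℕ) (g : Rn n → ℂ) : Prop :=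
  ∀ᵐ x ∂volume, ‖g x‖ₑ ≤
    ∫⁻ y, ENNReal.ofReal (((2 : ℝ) ^ j) ^ n) * ‖η ((2 : ℝ) ^ j • (y - x))‖ₑ * ‖g y‖ₑ

/-- The bootstrap estimate for a weighted function `W g`; the constant depends only on `η`, on
`r` and on the growth `A`, `M` of the weight. -/
lemma exists_weighted_le (η : 𝓢(Rn n, ℂ)) {p : Rn n → ℝ} {r : ℝ} (hr0 : 0 < r) (hr1 : r ≤ 1)
    (hrp : ∀ᵐ y ∂volume, r ≤ p y) {A : ℝ} (hA : 0 ≤ A) (M : ℕ) :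
    ∃ B : ℝ≥0, ∀ (j : ℕ) (g : Rn n → ℂ) (W : Rn n → ℝ), Continuous g → Continuous W →
      (∀ x, 0 < W x) →
      (∀ x y, W x ≤ A * (1 + (2 : ℝ) ^ j * ‖x - y‖) ^ M * W y) →
      (∃ S : ℝ, ∀ x, W x * ‖g x‖ ≤ S) →
      DominatedByAverage η j g →
      ∫⁻ y, ENNReal.ofReal (((2 : ℝ) ^ j) ^ n) * ENNReal.ofReal (W y * ‖g y‖) ^ p y ≤ 1 →
      ∀ x, ENNReal.ofReal (W x * ‖g x‖) ≤ B := by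
  obtain ⟨T, hT, hTs, hTi⟩ := exists_weighted_bound η M A
  have htop : (2 * T) ^ (1 / r) ≠ ∞ :=
    ENNReal.rpow_ne_top_of_nonneg (by positivity) (ENNReal.mul_ne_top (by simp) hT)
  refine ⟨((2 * T) ^ (1 / r)).toNNReal, fun j g W hg hW hWpos hWle ⟨S, hS⟩ hrep hmod x => ?_⟩
  rw [ENNReal.coe_toNNReal htop]
  set k : Rn n → ℝ≥0∞ := fun z => ENNReal.ofReal (A * (1 + ‖z‖) ^ M * ‖η z‖) with hk
  have hkm : Measurable k := by
    have := η.continuous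
    fun_prop
  refine le_of_le_average (κ := fun x y =>
      ENNReal.ofReal (((2 : ℝ) ^ j) ^ n) * k ((2 : ℝ) ^ j • (y - x)))
    (N := ENNReal.ofReal (((2 : ℝ) ^ j) ^ n)) hr0 hr1 hrp
    (K := fun x => ENNReal.ofReal (W x * ‖g x‖)) (ENNReal.continuous_ofReal.comp (by fun_prop)) (fun x => by fun_prop)
    (fun x => (lintegral_comp_two_pow_smul_sub k hkm j x).trans_le hTi)
    (fun x y => ?_) (S₀ := ENNReal.ofReal S) ENNReal.ofReal_ne_top
    (fun x => ENNReal.ofReal_le_ofReal (hS x)) ?_ hT hmod x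
  · rw [mul_comm]
    gcongr
    exact hTs _
  · filter_upwards [hrep] with x hx
    rw [ENNReal.ofReal_mul (hWpos x).le, ofReal_norm]
    calc ENNReal.ofReal (W x) * ‖g x‖ₑ
        ≤ ENNReal.ofReal (W x) * _ := by gcongr
      _ = ∫⁻ y, ENNReal.ofReal (W x) * (ENNReal.ofReal (((2 : ℝ) ^ j) ^ n) *
            ‖η ((2 : ℝ) ^ j • (y - x))‖ₑ * ‖g y‖ₑ) :=
          (lintegral_const_mul' _ _ ENNReal.ofReal_ne_top).symm
      _ ≤ _ := by
          refine lintegral_mono fun y => ?_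
          have hz : ‖(2 : ℝ) ^ j • (y - x)‖ = (2 : ℝ) ^ j * ‖x - y‖ := by
            rw [norm_smul, norm_sub_rev, Real.norm_of_nonneg (by positivity)]
          simp only [hk, hz]
          rw [← ofReal_norm, ← ofReal_norm, ← ENNReal.ofReal_mul (by positivity),
            ← ENNReal.ofReal_mul (by positivity), ← ENNReal.ofReal_mul (hWpos x).le,
            ← ENNReal.ofReal_mul (by positivity), ← ENNReal.ofReal_mul (by positivity)]
          apply ENNReal.ofReal_le_ofReal
          have := hWle x y
          calc W x * (((2 : ℝ) ^ j) ^ n * ‖η ((2 : ℝ) ^ j • (y - x))‖ * ‖g y‖)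
              ≤ (A * (1 + (2 : ℝ) ^ j * ‖x - y‖) ^ M * W y) *
                (((2 : ℝ) ^ j) ^ n * ‖η ((2 : ℝ) ^ j • (y - x))‖ * ‖g y‖) := by gcongr
            _ = _ := by ring

/-! ### The Plancherel–Pólya–Nikolskii inequality with variable exponents -/

lemma one_add_norm_le_mul (x y : Rn n) : 1 + ‖x‖ ≤ (1 + ‖y‖) * (1 + ‖x - y‖) := by
  have h1 : ‖x‖ ≤ ‖y‖ + ‖x - y‖ := by
    simpa using norm_add_le y (x - y)
  nlinarith [mul_nonneg (norm_nonneg y) (norm_nonneg (x - y))]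

/-- The heart of the Sobolev embedding: a continuous function of polynomial growth that is
dominated by its averages at scale `2⁻ʲ` satisfies `2^{j(s - n/p)} |g| ≤ B l` as soon as
`2^{js} g / l` has modular at most one. -/
theorem exists_pointwise_bound (η : 𝓢(Rn n, ℂ)) {p s : Rn n → ℝ} (hp : IsExponent p)
    (hpl : IsLogHolder p) (hs : IsLogHolder s) :
    ∃ B : ℝ≥0, ∀ (j : ℕ) (g : Rn n → ℂ), Continuous g →
      (∃ (C : ℝ) (k : ℕ), ∀ x, ‖g x‖ ≤ C * (1 + ‖x‖) ^ k) →
      DominatedByAverage η j g →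
      ∀ l : ℝ≥0, 0 < l →
      ∫⁻ x, (ENNReal.ofReal ((2 : ℝ) ^ ((j : ℝ) * s x)) * ‖g x‖ₑ / (l : ℝ≥0∞)) ^ p x ≤ 1 →
      ∀ x, ENNReal.ofReal ((2 : ℝ) ^ ((j : ℝ) * (s x - n / p x))) * ‖g x‖ₑ ≤ B * l := by
  obtain ⟨c, hc, hcp⟩ := hp.ess_lower
  obtain ⟨C, hC, ha⟩ := exists_locLogHolder_sub_div hp hpl hs
  have hac := ha.continuous
  obtain ⟨A, M, hA, hw⟩ := ha.exists_weight_le hC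
  set a : Rn n → ℝ := fun x => s x - n / p x with ha_def
  have hr0 : 0 < min c 1 := lt_min hc one_pos
  have hrp : ∀ᵐ y ∂volume, min c 1 ≤ p y := hcp.mono fun y hy => (min_le_left _ _).trans hy
  obtain ⟨B, hB⟩ := exists_weighted_le η hr0 (min_le_right c 1) hrp (zero_le_one.trans hA) M
  refine ⟨B, fun j g hg ⟨Cg, k, hgrow⟩ hrep l hl hmod x => ?_⟩
  have hCg : 0 ≤ Cg := by simpa using (norm_nonneg _).trans (hgrow 0)
  have hl' : (0 : ℝ) < l := hl
  set W : Rn n → ℝ := fun y => (2 : ℝ) ^ ((j : ℝ) * a y) / l with hW_def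
  have hWc : Continuous W :=
    (continuous_const.rpow (by fun_prop) fun _ => Or.inl two_ne_zero).div_const _
  have hWpos : ∀ y, 0 < W y := fun y => by positivity
  have hWle : ∀ x y, W x ≤ A * (1 + (2 : ℝ) ^ j * ‖x - y‖) ^ M * W y := fun x y => by
    simp only [hW_def]
    rw [← mul_div_assoc]
    gcongr
    exact hw j x y
  have hmodW : ∫⁻ y, ENNReal.ofReal (((2 : ℝ) ^ j) ^ n) *
      ENNReal.ofReal (W y * ‖g y‖) ^ p y ≤ 1 := by
    refine (lintegral_mono fun y => le_of_eq ?_).trans hmod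
    have hpy := hp.pos y
    rw [← ofReal_norm, ← ENNReal.ofReal_mul (by positivity), ← ENNReal.ofReal_coe_nnreal,
      ← ENNReal.ofReal_div_of_pos hl', ENNReal.ofReal_rpow_of_nonneg (by positivity) hpy.le,
      ENNReal.ofReal_rpow_of_nonneg (by positivity) hpy.le, ← ENNReal.ofReal_mul (by positivity)]
    congr 1
    have e1 : ((2 : ℝ) ^ j) ^ n = ((2 : ℝ) ^ ((j : ℝ) * (n / p y))) ^ p y := by
      rw [← Real.rpow_mul two_pos.le, ← pow_mul, ← Real.rpow_natCast]
      congr 1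
      push_cast
      field_simp
    rw [e1, ← Real.mul_rpow (by positivity) (by positivity)]
    congr 1
    simp only [hW_def, ha_def]
    rw [mul_div_right_comm, ← mul_assoc, ← mul_div_assoc, ← Real.rpow_add two_pos]
    congr 4
    ring
  have h2j : (1 : ℝ) ≤ (2 : ℝ) ^ j := one_le_pow₀ one_le_two
  -- Qualitative boundedness of `W g`: damp `W` by `(1 + |· - x₀|) ^ (-L)`, with `L` depending on
  -- the growth of `g`, and evaluate the bootstrap estimate at `x₀`.
  have hbdd : ∃ S : ℝ, ∀ x, W x * ‖g x‖ ≤ S := by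
    obtain ⟨B', hB'⟩ := exists_weighted_le η hr0 (min_le_right c 1) hrp (zero_le_one.trans hA)
      (M + (M + k))
    refine ⟨B', fun x₀ => ?_⟩
    set V : Rn n → ℝ := fun y => W y / (1 + ‖y - x₀‖) ^ (M + k) with hV_def
    have hden : ∀ y, 1 ≤ (1 + ‖y - x₀‖) ^ (M + k) := fun y =>
      one_le_pow₀ (by linarith [norm_nonneg (y - x₀)])
    have hVpos : ∀ y, 0 < V y := fun y => div_pos (hWpos y) (one_pos.trans_le (hden y))
    have hVW : ∀ y, V y ≤ W y := fun y => div_le_self (hWpos y).le (hden y)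
    have h := hB' j g V hg (hWc.div (by fun_prop) fun y => (one_pos.trans_le (hden y)).ne')
      hVpos ?_ ?_ hrep ?_ x₀
    · have hx₀ : V x₀ = W x₀ := by simp [hV_def]
      rw [hx₀, ← ENNReal.ofReal_coe_nnreal] at h
      exact (ENNReal.ofReal_le_ofReal_iff B'.2).1 h
    · intro x y
      have h1 : (1 + ‖y - x₀‖) ^ (M + k) ≤
          (1 + (2 : ℝ) ^ j * ‖x - y‖) ^ (M + k) * (1 + ‖x - x₀‖) ^ (M + k) := by
        rw [← mul_pow]
        gcongr
        have h2 := one_add_norm_le_mul (y - x₀) (x - x₀)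
        have h3 : ‖y - x₀ - (x - x₀)‖ ≤ (2 : ℝ) ^ j * ‖x - y‖ := by
          rw [sub_sub_sub_cancel_right, norm_sub_rev]
          exact le_mul_of_one_le_left (norm_nonneg _) h2j
        calc _ ≤ _ := h2
          _ ≤ (1 + ‖x - x₀‖) * (1 + (2 : ℝ) ^ j * ‖x - y‖) := by gcongr
          _ = _ := mul_comm _ _
      simp only [hV_def]
      rw [pow_add _ M (M + k), div_le_iff₀ (one_pos.trans_le (hden x)), ← mul_div_assoc, div_mul_eq_mul_div,
        le_div_iff₀ (one_pos.trans_le (hden y))]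
      calc W x * (1 + ‖y - x₀‖) ^ (M + k)
          ≤ (A * (1 + (2 : ℝ) ^ j * ‖x - y‖) ^ M * W y) *
            ((1 + (2 : ℝ) ^ j * ‖x - y‖) ^ (M + k) * (1 + ‖x - x₀‖) ^ (M + k)) := by
            gcongr
            exact hWle x y
        _ = _ := by ring
    · refine ⟨A * ((2 : ℝ) ^ j) ^ M * W x₀ * (Cg * (1 + ‖x₀‖) ^ k), fun y => ?_⟩
      have h1 : (1 + (2 : ℝ) ^ j * ‖y - x₀‖) ^ M ≤ ((2 : ℝ) ^ j) ^ M * (1 + ‖y - x₀‖) ^ M := by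
        rw [← mul_pow, mul_add, mul_one]
        gcongr
      have h2 : (1 + ‖y‖) ^ k ≤ (1 + ‖x₀‖) ^ k * (1 + ‖y - x₀‖) ^ k := by
        rw [← mul_pow]
        gcongr
        exact one_add_norm_le_mul y x₀
      have hx₀ := hWpos x₀
      have hden' := one_pos.trans_le (hden y)
      simp only [hV_def]
      rw [div_mul_eq_mul_div, div_le_iff₀ hden']
      calc W y * ‖g y‖
          ≤ (A * (1 + (2 : ℝ) ^ j * ‖y - x₀‖) ^ M * W x₀) * (Cg * (1 + ‖y‖) ^ k) := by
            gcongr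
            · exact hWle y x₀
            · exact hgrow y
        _ ≤ (A * (((2 : ℝ) ^ j) ^ M * (1 + ‖y - x₀‖) ^ M) * W x₀) *
            (Cg * ((1 + ‖x₀‖) ^ k * (1 + ‖y - x₀‖) ^ k)) := by gcongr
        _ = _ := by rw [pow_add]; ring
    · refine (lintegral_mono fun y => ?_).trans hmodW
      have := hp.pos y
      gcongr
      exact hVW y
  have h := hB j g W hg hWc hWpos hWle hbdd hrep hmodW x
  have hWx : ENNReal.ofReal ((2 : ℝ) ^ ((j : ℝ) * a x)) * ‖g x‖ₑ =
      ENNReal.ofReal (W x * ‖g x‖) * l := by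
    rw [← ofReal_norm, ← ENNReal.ofReal_coe_nnreal, ← ENNReal.ofReal_mul (by positivity),
      ← ENNReal.ofReal_mul (by positivity)]
    congr 1
    simp only [hW_def]
    field_simp
  exact hWx ▸ mul_le_mul_left h _

/-! ### The function represented by a tempered distribution -/

lemma locallyIntegrable_of_schwartz_mul {h : Rn n → ℂ}
    (hh : ∀ φ : 𝓢(Rn n, ℂ), Integrable fun x => φ x * h x) : LocallyIntegrable h := by
  intro x
  let b : ContDiffBump x := ⟨1, 2, one_pos, one_lt_two⟩
  have hc : HasCompactSupport fun y => ((b y : ℝ) : ℂ) :=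
    b.hasCompactSupport.comp_left Complex.ofReal_zero
  have hs : ContDiff ℝ ((⊤ : ℕ∞) : WithTop ℕ∞) fun y => ((b y : ℝ) : ℂ) := Complex.ofRealCLM.contDiff.comp b.contDiff
  refine ⟨Metric.closedBall x 1, Metric.closedBall_mem_nhds x one_pos, ?_⟩
  refine ((hh (hc.toSchwartzMap hs)).integrableOn (s := Metric.closedBall x 1)).congr_fun
    (fun y hy => ?_) Metric.isClosed_closedBall.measurableSet
  have : b y = 1 := b.one_of_mem_closedBall hy
  simp [this]

/-- Two functions that define the same tempered distribution agree almost everywhere. -/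
lemma ae_eq_of_integral_schwartz_mul_eq {g h : Rn n → ℂ}
    (hg : ∀ φ : 𝓢(Rn n, ℂ), Integrable fun x => φ x * g x)
    (hh : ∀ φ : 𝓢(Rn n, ℂ), Integrable fun x => φ x * h x)
    (heq : ∀ φ : 𝓢(Rn n, ℂ), ∫ x, φ x * g x = ∫ x, φ x * h x) : g =ᵐ[volume] h := by
  refine ae_eq_of_integral_contDiff_smul_eq (locallyIntegrable_of_schwartz_mul hg)
    (locallyIntegrable_of_schwartz_mul hh) fun b hb hbc => ?_
  have hc : HasCompactSupport fun y => ((b y : ℝ) : ℂ) := hbc.comp_left Complex.ofReal_zero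
  have hs : ContDiff ℝ ((⊤ : ℕ∞) : WithTop ℕ∞) fun y => ((b y : ℝ) : ℂ) := Complex.ofRealCLM.contDiff.comp hb
  simpa using heq (hc.toSchwartzMap hs)

lemma integrable_one_add_pow_mul_norm (η : 𝓢(Rn n, ℂ)) (k : ℕ) :
    Integrable fun z => (1 + ‖z‖) ^ k * ‖η z‖ := by
  have hη := η.continuous
  refine ⟨by fun_prop, ?_⟩
  obtain ⟨T, hT, -, hi⟩ := exists_weighted_bound η k 1
  rw [hasFiniteIntegral_iff_ofReal (Eventually.of_forall fun z => by positivity)]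
  simpa using hi.trans_lt hT.lt_top

lemma integrable_schwartz_mul {g : Rn n → ℂ} (hg : Continuous g) {C : ℝ} {k : ℕ}
    (h : ∀ x, ‖g x‖ ≤ C * (1 + ‖x‖) ^ k) (φ : 𝓢(Rn n, ℂ)) :
    Integrable fun x => φ x * g x := by
  have hφ := φ.continuous
  refine ((integrable_one_add_pow_mul_norm φ k).const_mul C).mono' (by fun_prop)
    (Eventually.of_forall fun x => ?_)
  rw [norm_mul]
  calc ‖φ x‖ * ‖g x‖ ≤ ‖φ x‖ * (C * (1 + ‖x‖) ^ k) := by gcongr; exact h x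
    _ = _ := by ring

lemma IsFunction.integrable {u : 𝓢'(Rn n, ℂ)} {g : Rn n → ℂ} (h : IsFunction u g)
    (φ : 𝓢(Rn n, ℂ)) : Integrable fun x => φ x * g x :=
  let ⟨_, _, hg⟩ := h.growth
  integrable_schwartz_mul h.continuous hg φ

lemma IsFunction.unique {u : 𝓢'(Rn n, ℂ)} {g h : Rn n → ℂ} (hg : IsFunction u g)
    (hh : IsFunction u h) : g = h :=
  (Continuous.ae_eq_iff_eq volume hg.continuous hh.continuous).1 <|
    ae_eq_of_integral_schwartz_mul_eq hg.integrable hh.integrable fun φ => by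
      rw [← hg.eq_integral, ← hh.eq_integral]

/-! ### Convolution with the kernel of a Fourier multiplier -/

lemma integral_fourierInv_mul_eq {f g : Rn n → ℂ} (hf : Integrable f) (hg : Integrable g) :
    ∫ ξ, 𝓕⁻ f ξ * g ξ = ∫ x, f x * 𝓕⁻ g x := by
  have hL : Continuous fun q : Rn n × Rn n => (-innerₗ (Rn n)) q.1 q.2 :=
    (continuous_inner (𝕜 := ℝ) (E := Rn n)).neg
  have hflip : (-innerₗ (Rn n)).flip = -innerₗ (Rn n) := by
    ext x y
    simp [real_inner_comm]
  have h := VectorFourier.integral_fourierIntegral_smul_eq_flip (μ := volume) (ν := volume)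
    (L := -innerₗ (Rn n)) Real.continuous_fourierChar hL hf hg
  rw [hflip] at h
  exact h

/-- The transpose of the Fourier multiplier with symbol `Ψ`, as an integral operator. -/
lemma fourier_smulLeft_fourierInv_apply (Ψ φ : 𝓢(Rn n, ℂ)) (x : Rn n) :
    𝓕 (SchwartzMap.smulLeftCLM ℂ Ψ (𝓕⁻ φ)) x = ∫ y, 𝓕 Ψ (x - y) * φ y := by
  have hint : Integrable fun ξ => Real.fourierChar (-⟪ξ, x⟫) • Ψ ξ :=
    (Real.fourierIntegral_convergent_iff x).2 Ψ.integrable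
  have h1 : 𝓕 (SchwartzMap.smulLeftCLM ℂ Ψ (𝓕⁻ φ)) x =
      ∫ ξ, (Real.fourierChar (-⟪ξ, x⟫) • Ψ ξ) * 𝓕⁻ (φ : Rn n → ℂ) ξ := by
    rw [SchwartzMap.fourier_coe, Real.fourier_eq]
    refine integral_congr_ae (Eventually.of_forall fun ξ => ?_)
    dsimp only
    rw [SchwartzMap.smulLeftCLM_apply_apply Ψ.hasTemperateGrowth, SchwartzMap.fourierInv_coe,
      smul_eq_mul, smul_mul_assoc]
  have h2 : ∀ y, 𝓕⁻ (fun ξ => Real.fourierChar (-⟪ξ, x⟫) • Ψ ξ) y = 𝓕 Ψ (x - y) := by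
    intro y
    rw [SchwartzMap.fourier_coe, Real.fourier_eq, Real.fourierInv_eq]
    refine integral_congr_ae (Eventually.of_forall fun ξ => ?_)
    dsimp only
    rw [smul_smul, ← AddChar.map_add_eq_mul, inner_sub_right, neg_sub, sub_eq_add_neg]
  rw [h1, ← integral_fourierInv_mul_eq hint φ.integrable]
  simp only [h2]

/-- If `u` is invariant under the Fourier multiplier `Ψ(D)`, then the function `g` defining `u` is
its own convolution with the kernel of `Ψ(D)`. -/
lemma IsFunction.ae_eq_convolution {u : 𝓢'(Rn n, ℂ)} {g : Rn n → ℂ} (hg : IsFunction u g)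
    (Ψ : 𝓢(Rn n, ℂ)) (hΨ : TemperedDistribution.fourierMultiplierCLM ℂ (Ψ : Rn n → ℂ) u = u) :
    g =ᵐ[volume] fun x => ∫ y, 𝓕 Ψ (y - x) * g y := by
  obtain ⟨C, k, hgrow⟩ := hg.growth
  have hgc := hg.continuous
  have hC : 0 ≤ C := by simpa using (norm_nonneg _).trans (hgrow 0)
  set η : 𝓢(Rn n, ℂ) := 𝓕 Ψ with hη
  have hηc := η.continuous
  have hprod : ∀ φ : 𝓢(Rn n, ℂ),
      Integrable (fun q : Rn n × Rn n => η (q.1 - q.2) * φ q.2 * g q.1) (volume.prod volume) := by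
    intro φ
    have hφc := φ.continuous
    have hi := ((integrable_one_add_pow_mul_norm φ k).const_mul C).convolution_integrand
      (ContinuousLinearMap.mul ℝ ℝ) (integrable_one_add_pow_mul_norm η k)
    refine hi.mono' (by fun_prop) (Eventually.of_forall fun q => ?_)
    rw [norm_mul, norm_mul, ContinuousLinearMap.mul_apply']
    calc ‖η (q.1 - q.2)‖ * ‖φ q.2‖ * ‖g q.1‖
        ≤ ‖η (q.1 - q.2)‖ * ‖φ q.2‖ * (C * ((1 + ‖q.2‖) * (1 + ‖q.1 - q.2‖)) ^ k) := by
          gcongr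
          refine (hgrow _).trans ?_
          gcongr
          exact one_add_norm_le_mul _ _
      _ = _ := by rw [mul_pow]; ring
  have hswap : ∀ φ : 𝓢(Rn n, ℂ), ∀ y : Rn n,
      ∫ x, η (x - y) * φ y * g x = φ y * ∫ x, η (x - y) * g x := by
    intro φ y
    rw [← integral_const_mul]
    congr 1
    ext x
    ring
  refine ae_eq_of_integral_schwartz_mul_eq hg.integrable (fun φ => ?_) fun φ => ?_
  · simpa only [hswap] using (hprod φ).integral_prod_right
  · rw [← hg.eq_integral φ]
    conv_lhs => rw [← hΨ]
    rw [TemperedDistribution.fourierMultiplierCLM_apply_apply, hg.eq_integral]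
    simp_rw [fourier_smulLeft_fourierInv_apply, ← hη, ← integral_mul_const]
    rw [integral_integral_swap (hprod φ)]
    simp only [hswap]

/-! ### The kernel of the frequency cut-off at scale `2ʲ` -/

/-- The dilation `Ψ(2⁻ʲ ·)`. -/
noncomputable def dilate (j : ℕ) (Ψ : 𝓢(Rn n, ℂ)) : 𝓢(Rn n, ℂ) :=
  SchwartzMap.compCLMOfContinuousLinearEquiv ℂ
    (ContinuousLinearEquiv.smulLeft (R₁ := ℝ) (M₁ := Rn n)
      (Units.mk0 ((2 : ℝ) ^ j) (by positivity))⁻¹) Ψ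

lemma dilate_apply (j : ℕ) (Ψ : 𝓢(Rn n, ℂ)) (x : Rn n) :
    dilate j Ψ x = Ψ (((2 : ℝ) ^ j)⁻¹ • x) := rfl

lemma fourier_dilate_apply (j : ℕ) (Ψ : 𝓢(Rn n, ℂ)) (z : Rn n) :
    𝓕 (dilate j Ψ) z = (((2 : ℝ) ^ j) ^ n : ℝ) • 𝓕 Ψ ((2 : ℝ) ^ j • z) := by
  have h2 : ((2 : ℝ) ^ j) ≠ 0 := by positivity
  rw [SchwartzMap.fourier_coe, SchwartzMap.fourier_coe, Real.fourier_eq, Real.fourier_eq]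
  have := Measure.integral_comp_smul (volume : Measure (Rn n))
    (fun ξ => Real.fourierChar (-⟪ξ, (2 : ℝ) ^ j • z⟫) • Ψ ξ) (((2 : ℝ) ^ j)⁻¹)
  rw [finrank_euclideanSpace_fin, inv_pow, inv_inv, abs_of_pos (by positivity)] at this
  rw [← this]
  refine integral_congr_ae (Eventually.of_forall fun ξ => ?_)
  simp only [dilate_apply]
  rw [real_inner_smul_left, real_inner_smul_right, inv_mul_cancel_left₀ h2]

lemma exists_schwartz_cutoff (n : ℕ) :
    ∃ Ψ : 𝓢(Rn n, ℂ), ∀ x : Rn n, ‖x‖ ≤ 2 → Ψ x = 1 := by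
  let b : ContDiffBump (0 : Rn n) := ⟨2, 3, two_pos, by norm_num⟩
  have hc : HasCompactSupport fun y => ((b y : ℝ) : ℂ) :=
    b.hasCompactSupport.comp_left Complex.ofReal_zero
  have hs : ContDiff ℝ ((⊤ : ℕ∞) : WithTop ℕ∞) fun y => ((b y : ℝ) : ℂ) := Complex.ofRealCLM.contDiff.comp b.contDiff
  refine ⟨hc.toSchwartzMap hs, fun x hx => ?_⟩
  have : b x = 1 := b.one_of_mem_closedBall (by simpa using hx)
  simp [this]

lemma IsResolution.eq_zero_of_lt {θ : ℕ → 𝓢(Rn n, ℂ)} (hθ : IsResolution θ) {j : ℕ} {x : Rn n}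
    (hx : (2 : ℝ) ^ (j + 1) < ‖x‖) : θ j x = 0 := by
  by_contra h
  have hmem : x ∈ tsupport (θ j : Rn n → ℂ) := subset_tsupport _ h
  rcases Nat.eq_zero_or_pos j with rfl | hj
  · have : ‖x‖ ≤ 2 := hθ.supp_zero hmem
    norm_num at hx
    linarith
  · exact absurd (hθ.supp_succ j hj hmem).2 (not_le.2 hx)

/-- The Littlewood–Paley blocks are reproduced by the frequency cut-off at scale `2ʲ`. -/
lemma IsResolution.fourierMultiplier_block {θ : ℕ → 𝓢(Rn n, ℂ)} (hθ : IsResolution θ)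
    {Ψ : 𝓢(Rn n, ℂ)} (hΨ : ∀ x : Rn n, ‖x‖ ≤ 2 → Ψ x = 1) (j : ℕ) (f : 𝓢'(Rn n, ℂ)) :
    TemperedDistribution.fourierMultiplierCLM ℂ (dilate j Ψ : Rn n → ℂ) (block θ j f) =
      block θ j f := by
  rw [block, TemperedDistribution.fourierMultiplierCLM_fourierMultiplierCLM_apply
    (θ j).hasTemperateGrowth (dilate j Ψ).hasTemperateGrowth]
  congr 2
  ext x
  rw [Pi.mul_apply, dilate_apply]
  rcases le_or_gt ‖x‖ ((2 : ℝ) ^ (j + 1)) with hx | hx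
  · rw [hΨ, mul_one]
    rw [norm_smul, norm_inv, Real.norm_of_nonneg (by positivity), inv_mul_le_iff₀ (by positivity)]
    exact hx.trans_eq (pow_succ _ _)
  · rw [hθ.eq_zero_of_lt hx, zero_mul]

/-- The reproducing formula for the blocks. -/
lemma IsResolution.block_ae_eq {θ : ℕ → 𝓢(Rn n, ℂ)} (hθ : IsResolution θ)
    {Ψ : 𝓢(Rn n, ℂ)} (hΨ : ∀ x : Rn n, ‖x‖ ≤ 2 → Ψ x = 1) {j : ℕ} {f : 𝓢'(Rn n, ℂ)}
    {g : Rn n → ℂ} (hg : IsFunction (block θ j f) g) :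
    g =ᵐ[volume] fun x => ∫ y, 𝓕 (dilate j Ψ) (y - x) * g y :=
  hg.ae_eq_convolution _ (hθ.fourierMultiplier_block hΨ j f)

lemma IsResolution.dominatedByAverage {θ : ℕ → 𝓢(Rn n, ℂ)} (hθ : IsResolution θ)
    {Ψ : 𝓢(Rn n, ℂ)} (hΨ : ∀ x : Rn n, ‖x‖ ≤ 2 → Ψ x = 1) {j : ℕ} {f : 𝓢'(Rn n, ℂ)}
    {g : Rn n → ℂ} (hg : IsFunction (block θ j f) g) : DominatedByAverage (𝓕 Ψ) j g := by
  filter_upwards [hθ.block_ae_eq hΨ hg] with x hx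
  calc ‖g x‖ₑ = ‖∫ y, 𝓕 (dilate j Ψ) (y - x) * g y‖ₑ := by rw [← hx]
    _ ≤ ∫⁻ y, ‖𝓕 (dilate j Ψ) (y - x) * g y‖ₑ := enorm_integral_le_lintegral_enorm _
    _ = _ := by
      refine lintegral_congr fun y => ?_
      rw [enorm_mul, fourier_dilate_apply, enorm_smul, Real.enorm_of_nonneg (by positivity)]

/-! ### The quasi-norms control the modulars of the single functions -/

/-- `N` bounds the `L^{p(·)}` quasi-norm of every member of a sequence, up to a constant. This is
phrased with modulars: every `t` above `N F` majorizes some `m` for which `F j / (c m)` has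
modular at most one, for all `j`. -/
def ControlsModulars (p : Rn n → ℝ) (N : (ℕ → Rn n → ℝ≥0∞) → ℝ≥0∞) : Prop :=
  ∃ c : ℝ≥0, 0 < c ∧ ∀ (F : ℕ → Rn n → ℝ≥0∞) (t : ℝ≥0∞), N F < t →
    ∃ m : ℝ≥0, 0 < m ∧ (m : ℝ≥0∞) ≤ t ∧
      ∀ j, ∫⁻ x, (F j x / ((c * m : ℝ≥0) : ℝ≥0∞)) ^ p x ≤ 1

lemma controlsModulars_lpSeqNorm {p q : Rn n → ℝ} (hp : IsExponent p) (hq : IsExponent q) :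
    ControlsModulars p (lpSeqNorm p q) := by
  refine ⟨1, one_pos, fun F t ht => ?_⟩
  simp only [lpSeqNorm, luxNorm, iInf_lt_iff] at ht
  obtain ⟨m, hm, hmod, hmt⟩ := ht
  refine ⟨m, hm, hmt.le, fun j => (lintegral_mono fun x => ?_).trans hmod⟩
  have hqx := hq.pos x
  have hpx := hp.pos x
  rw [one_mul]
  gcongr
  calc F j x = (F j x ^ q x) ^ (1 / q x) := by
        rw [← ENNReal.rpow_mul, mul_one_div_cancel hqx.ne', ENNReal.rpow_one]
    _ ≤ _ := by
        gcongr
        exact ENNReal.le_tsum (f := fun j => F j x ^ q x) j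

lemma controlsModulars_seqLpNorm {p q : Rn n → ℝ} (hp : IsExponent p) (hq : IsExponent q) :
    ControlsModulars p (seqLpNorm p q) := by
  obtain ⟨c, hc, hcq⟩ := hq.ess_lower
  refine ⟨2 ^ (1 / c), by positivity, fun F t ht => ?_⟩
  simp only [seqLpNorm, iInf_lt_iff] at ht
  obtain ⟨m, hm, hmod, hmt⟩ := ht
  refine ⟨m, hm, hmt.le, fun j => ?_⟩
  -- each term of the mixed modular is at most `1`, hence less than `2`
  have hj := ((ENNReal.le_tsum j).trans hmod).trans_lt ENNReal.one_lt_two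
  simp only [iInf_lt_iff] at hj
  obtain ⟨l, hl, hlmod, hl2⟩ := hj
  refine (lintegral_mono_ae ?_).trans hlmod
  filter_upwards [hcq] with x hx
  have hpx := hp.pos x
  have hle : (l : ℝ≥0∞) ^ (1 / q x) ≤ ((2 ^ (1 / c) : ℝ≥0) : ℝ≥0∞) := by
    rw [ENNReal.coe_rpow_of_nonneg _ (by positivity)]
    calc (l : ℝ≥0∞) ^ (1 / q x) ≤ 2 ^ (1 / q x) :=
          ENNReal.rpow_le_rpow hl2.le (one_div_nonneg.2 (hq.pos x).le)
      _ ≤ _ := ENNReal.rpow_le_rpow_of_exponent_le (by simp) (one_div_le_one_div_of_le hc hx)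
  refine ENNReal.rpow_le_rpow ?_ hpx.le
  calc F j x / ((2 ^ (1 / c) * m : ℝ≥0) : ℝ≥0∞)
      = F j x / m / ((2 ^ (1 / c) : ℝ≥0) : ℝ≥0∞) := by
        rw [ENNReal.coe_mul, mul_comm, div_eq_mul_inv, ENNReal.mul_inv (by simp) (by simp),
          ← mul_assoc, ← div_eq_mul_inv, ← div_eq_mul_inv]
    _ ≤ _ := ENNReal.div_le_div_left hle _

/-! ### The Sobolev embeddings -/

lemma blockNorm_eq {θ : ℕ → 𝓢(Rn n, ℂ)} {f : 𝓢'(Rn n, ℂ)} {g : ℕ → Rn n → ℂ}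
    (hg : ∀ j, IsFunction (block θ j f) (g j)) (N : (ℕ → Rn n → ℝ≥0∞) → ℝ≥0∞) (a : Rn n → ℝ) :
    blockNorm N θ a f =
      N (fun j x => ENNReal.ofReal ((2 : ℝ) ^ ((j : ℝ) * a x)) * ‖g j x‖ₑ) := by
  refine le_antisymm (iInf₂_le g hg) (le_iInf₂ fun g' hg' => ?_)
  obtain rfl : g = g' := funext fun j => (hg j).unique (hg' j)
  exact le_rfl

lemma exists_isFunction_of_blockNorm_lt_top {N : (ℕ → Rn n → ℝ≥0∞) → ℝ≥0∞}
    {θ : ℕ → 𝓢(Rn n, ℂ)} {a : Rn n → ℝ} {f : 𝓢'(Rn n, ℂ)} (h : blockNorm N θ a f < ∞) :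
    ∃ g : ℕ → Rn n → ℂ, ∀ j, IsFunction (block θ j f) (g j) := by
  simp only [blockNorm, iInf_lt_iff] at h
  obtain ⟨g, hg, -⟩ := h
  exact ⟨g, hg⟩

/-- A pointwise bound on the blocks by every majorant of the quasi-norm gives an embedding. -/
lemma embeds_blockNorm_of_forall {N₁ N₂ : (ℕ → Rn n → ℝ≥0∞) → ℝ≥0∞} {θ : ℕ → 𝓢(Rn n, ℂ)}
    {a₁ a₂ : Rn n → ℝ} {C : ℝ≥0}
    (h : ∀ (f : 𝓢'(Rn n, ℂ)) (g : ℕ → Rn n → ℂ), (∀ j, IsFunction (block θ j f) (g j)) →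
      ∀ t : ℝ≥0∞, N₁ (fun j x => ENNReal.ofReal ((2 : ℝ) ^ ((j : ℝ) * a₁ x)) * ‖g j x‖ₑ) < t →
        N₂ (fun j x => ENNReal.ofReal ((2 : ℝ) ^ ((j : ℝ) * a₂ x)) * ‖g j x‖ₑ) ≤ C * t) :
    Embeds (blockNorm N₁ θ a₁) (blockNorm N₂ θ a₂) := by
  refine ⟨C + 1, fun f hf => ?_⟩
  obtain ⟨g, hg⟩ := exists_isFunction_of_blockNorm_lt_top hf
  rw [blockNorm_eq hg, blockNorm_eq hg]
  have hC0 : ((C + 1 : ℝ≥0) : ℝ≥0∞) ≠ 0 := by simp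
  rw [← ENNReal.div_le_iff' hC0 ENNReal.coe_ne_top]
  refine le_of_forall_gt_imp_ge_of_dense fun t ht => ?_
  rw [ENNReal.div_le_iff' hC0 ENNReal.coe_ne_top]
  refine (h f g hg t ht).trans ?_
  gcongr
  exact le_self_add

/-- The pointwise bound on the blocks behind both embeddings. -/
lemma IsResolution.exists_block_bound {θ : ℕ → 𝓢(Rn n, ℂ)} (hθ : IsResolution θ)
    {p s : Rn n → ℝ} (hp : IsExponent p) (hpl : IsLogHolder p) (hs : IsLogHolder s)
    {N : (ℕ → Rn n → ℝ≥0∞) → ℝ≥0∞} (hN : ControlsModulars p N) :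
    ∃ B : ℝ≥0, ∀ (f : 𝓢'(Rn n, ℂ)) (g : ℕ → Rn n → ℂ), (∀ j, IsFunction (block θ j f) (g j)) →
      ∀ t : ℝ≥0∞, N (fun j x => ENNReal.ofReal ((2 : ℝ) ^ ((j : ℝ) * s x)) * ‖g j x‖ₑ) < t →
        ∀ (j : ℕ) (x : Rn n), ENNReal.ofReal ((2 : ℝ) ^ ((j : ℝ) * (s x - n / p x))) * ‖g j x‖ₑ ≤ B * t := by
  obtain ⟨Ψ, hΨ⟩ := exists_schwartz_cutoff n
  obtain ⟨B, hB⟩ := exists_pointwise_bound (𝓕 Ψ) hp hpl hs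
  obtain ⟨c, hc, hcN⟩ := hN
  refine ⟨B * c, fun f g hg t ht j x => ?_⟩
  obtain ⟨m, hm, hmt, hmod⟩ := hcN _ t ht
  refine (hB j (g j) (hg j).continuous (hg j).growth (hθ.dominatedByAverage hΨ (hg j)) (c * m)
    (mul_pos hc hm) (hmod j) x).trans ?_
  rw [ENNReal.coe_mul, ENNReal.coe_mul, ← mul_assoc]
  gcongr

lemma IsResolution.embeds_inftyInfty {θ : ℕ → 𝓢(Rn n, ℂ)} (hθ : IsResolution θ)
    {p s : Rn n → ℝ} (hp : IsExponent p) (hpl : IsLogHolder p) (hs : IsLogHolder s)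
    {N : (ℕ → Rn n → ℝ≥0∞) → ℝ≥0∞} (hN : ControlsModulars p N) :
    Embeds (blockNorm N θ s) (besovInftyInftyNorm θ (fun x => s x - n / p x)) := by
  obtain ⟨B, hB⟩ := hθ.exists_block_bound hp hpl hs hN
  exact embeds_blockNorm_of_forall (C := B) fun f g hg t ht => iSup_le fun j =>
    essSup_le_of_ae_le _ (Eventually.of_forall (hB f g hg t ht j))

lemma IsResolution.embeds_inftyOne {θ : ℕ → 𝓢(Rn n, ℂ)} (hθ : IsResolution θ)
    {p s : Rn n → ℝ} (hp : IsExponent p) (hpl : IsLogHolder p) (hs : IsLogHolder s)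
    {N : (ℕ → Rn n → ℝ≥0∞) → ℝ≥0∞} (hN : ControlsModulars p N)
    {ε : ℝ} (hε : 0 < ε) (hps : ∀ᵐ x ∂volume, n / p x - s x ≤ -ε) :
    Embeds (blockNorm N θ s) (besovInftyOneNorm θ (fun _ => 0)) := by
  obtain ⟨B, hB⟩ := hθ.exists_block_bound hp hpl hs hN
  set ρ : ℝ≥0∞ := ENNReal.ofReal ((2 : ℝ) ^ (-ε)) with hρ
  have hρ1 : ρ < 1 := by
    rw [hρ, ENNReal.ofReal_lt_one]
    exact Real.rpow_lt_one_of_one_lt_of_neg one_lt_two (neg_lt_zero.2 hε)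
  have hsum : ∑' j : ℕ, ρ ^ j ≠ ∞ := by
    rw [ENNReal.tsum_geometric]
    exact ENNReal.inv_ne_top.2 (tsub_pos_of_lt hρ1).ne'
  refine embeds_blockNorm_of_forall (C := (∑' j : ℕ, ρ ^ j).toNNReal * B) fun f g hg t ht => ?_
  rw [ENNReal.coe_mul, ENNReal.coe_toNNReal hsum, mul_assoc, ← ENNReal.tsum_mul_right]
  refine ENNReal.tsum_le_tsum fun j => essSup_le_of_ae_le _ ?_
  filter_upwards [hps] with x hx
  rw [mul_zero, Real.rpow_zero, ENNReal.ofReal_one, one_mul]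
  have hpow : ρ ^ j * ENNReal.ofReal ((2 : ℝ) ^ ((j : ℝ) * ε)) = 1 := by
    rw [hρ, ← ENNReal.ofReal_pow (by positivity), ← ENNReal.ofReal_mul (by positivity),
      ← Real.rpow_natCast, ← Real.rpow_mul two_pos.le, ← Real.rpow_add two_pos]
    ring_nf
    simp
  calc ‖g j x‖ₑ = ρ ^ j * (ENNReal.ofReal ((2 : ℝ) ^ ((j : ℝ) * ε)) * ‖g j x‖ₑ) := by
        rw [← mul_assoc, hpow, one_mul]
    _ ≤ ρ ^ j * (ENNReal.ofReal ((2 : ℝ) ^ ((j : ℝ) * (s x - n / p x))) * ‖g j x‖ₑ) := by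
        gcongr
        · exact one_le_two
        · linarith
    _ ≤ ρ ^ j * (B * t) := mul_le_mul_right (hB f g hg t ht j x) _

/-! ### Convergence of the Littlewood–Paley decomposition -/

/-- The products `θ_j φ` are bounded in the Schwartz space. -/
lemma IsResolution.exists_seminorm_smul_le {θ : ℕ → 𝓢(Rn n, ℂ)} (hθ : IsResolution θ)
    (φ : 𝓢(Rn n, ℂ)) (k m : ℕ) :
    ∃ K : ℝ, ∀ j, SchwartzMap.seminorm ℂ k m (SchwartzMap.smulLeftCLM ℂ (θ j) φ) ≤ K := by
  choose c hc hcb using hθ.deriv_bound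
  refine ⟨∑ i ∈ Finset.range (m + 1), (m.choose i : ℝ) * c i *
    SchwartzMap.seminorm ℂ k (m - i) φ, fun j => ?_⟩
  refine SchwartzMap.seminorm_le_bound ℂ k m _ (Finset.sum_nonneg fun i _ => ?_) fun x => ?_
  · have := (hc i).le
    positivity
  have hcoe : (SchwartzMap.smulLeftCLM ℂ (θ j) φ : Rn n → ℂ) = fun x => θ j x * φ x := by
    ext x
    rw [SchwartzMap.smulLeftCLM_apply_apply (θ j).hasTemperateGrowth, smul_eq_mul]
  rw [hcoe]
  have h1 := norm_iteratedFDeriv_mul_le (𝕜 := ℝ) ((θ j).smooth ⊤) (φ.smooth ⊤) x (n := m)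
    (by exact_mod_cast le_top)
  calc ‖x‖ ^ k * ‖iteratedFDeriv ℝ m (fun x => θ j x * φ x) x‖
      ≤ ‖x‖ ^ k * ∑ i ∈ Finset.range (m + 1), (m.choose i : ℝ) *
          ‖iteratedFDeriv ℝ i (θ j) x‖ * ‖iteratedFDeriv ℝ (m - i) φ x‖ := by gcongr
    _ = ∑ i ∈ Finset.range (m + 1), (m.choose i : ℝ) * ‖iteratedFDeriv ℝ i (θ j) x‖ *
          (‖x‖ ^ k * ‖iteratedFDeriv ℝ (m - i) φ x‖) := by
        rw [Finset.mul_sum]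
        exact Finset.sum_congr rfl fun i _ => by ring
    _ ≤ _ := by
        gcongr with i _
        · exact mul_nonneg (Nat.cast_nonneg _) (hc i).le
        · refine (le_mul_of_one_le_left (norm_nonneg _) ?_).trans (hcb i j x)
          exact one_le_pow₀ one_le_two
        · exact φ.le_seminorm ℂ k (m - i) x

/-- On the ball of radius `2^J` the first `J + 1` functions of the resolution sum to one. -/
lemma IsResolution.sum_eq_one {θ : ℕ → 𝓢(Rn n, ℂ)} (hθ : IsResolution θ) {J : ℕ} {x : Rn n}
    (hx : ‖x‖ < (2 : ℝ) ^ J) : ∑ j ∈ Finset.range (J + 1), θ j x = 1 := by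
  refine (hasSum_sum_of_ne_finset_zero fun j hj => ?_).unique (hθ.hasSum_one x)
  have hj' : J + 1 ≤ j := by simpa using hj
  by_contra h
  have h2 := (hθ.supp_succ j (by omega) (subset_tsupport _ h)).1
  have h3 : (2 : ℝ) ^ J ≤ (2 : ℝ) ^ ((j : ℤ) - 1) := by
    rw [← zpow_natCast]
    exact zpow_le_zpow_right₀ one_le_two (by omega)
  linarith

/-- The Littlewood–Paley decomposition of a Schwartz function on the frequency side converges in
the Schwartz space. -/
lemma IsResolution.tendsto_sum_smul {θ : ℕ → 𝓢(Rn n, ℂ)} (hθ : IsResolution θ)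
    (φ : 𝓢(Rn n, ℂ)) :
    Tendsto (fun J => ∑ j ∈ Finset.range (J + 1), SchwartzMap.smulLeftCLM ℂ (θ j) φ) atTop
      (𝓝 φ) := by
  rw [(schwartz_withSeminorms ℂ (Rn n) ℂ).tendsto_nhds]
  rintro ⟨k, m⟩ ε hε
  obtain ⟨K, hK⟩ := hθ.exists_seminorm_smul_le φ (k + 1) m
  set S := SchwartzMap.seminorm ℂ (k + 1) m φ
  have hlim : Tendsto (fun J : ℕ => ((J : ℝ) * (1 / 2) ^ J) * K + (1 / 2) ^ J * (K + S)) atTop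
      (𝓝 0) := by
    have h1 := tendsto_self_mul_const_pow_of_lt_one (r := (1 / 2 : ℝ)) (by norm_num) (by norm_num)
    have h2 := tendsto_pow_atTop_nhds_zero_of_lt_one (r := (1 / 2 : ℝ)) (by norm_num) (by norm_num)
    simpa using (h1.mul_const K).add (h2.mul_const (K + S))
  filter_upwards [hlim.eventually_lt_const hε] with J hJ
  refine lt_of_le_of_lt ?_ hJ
  set D := ∑ j ∈ Finset.range (J + 1), SchwartzMap.smulLeftCLM ℂ (θ j) φ - φ with hD
  have hDS : SchwartzMap.seminorm ℂ (k + 1) m D ≤ (J + 1) * K + S := by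
    refine (map_sub_le_add _ _ _).trans ?_
    gcongr
    refine (Finset.le_sum_of_subadditive _ (map_zero _).le (map_add_le_add _) _ _).trans ?_
    refine (Finset.sum_le_sum fun j _ => hK j).trans ?_
    simp
  have hDx : ∀ x, ‖x‖ < (2 : ℝ) ^ J → D x = 0 := by
    intro x hx
    have : D x = (∑ j ∈ Finset.range (J + 1), θ j x) * φ x - φ x := by
      rw [hD, sub_apply, sum_apply, Finset.sum_mul]
      congr 1
      refine Finset.sum_congr rfl fun j _ => ?_
      rw [SchwartzMap.smulLeftCLM_apply_apply (θ j).hasTemperateGrowth, smul_eq_mul]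
    rw [this, hθ.sum_eq_one hx, one_mul, sub_self]
  have hbound : SchwartzMap.seminorm ℂ k m D ≤ (1 / 2) ^ J * ((J + 1) * K + S) := by
    have hnn : 0 ≤ (J + 1) * K + S := (apply_nonneg _ _).trans hDS
    refine SchwartzMap.seminorm_le_bound ℂ k m D (by positivity) fun x => ?_
    rcases lt_or_ge ‖x‖ ((2 : ℝ) ^ J) with hx | hx
    · have hloc : (D : Rn n → ℂ) =ᶠ[𝓝 x] 0 := by
        filter_upwards [(isOpen_lt continuous_norm continuous_const).mem_nhds hx] with y hy
        exact hDx y hy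
      rw [(hloc.iteratedFDeriv ℝ m).eq_of_nhds]
      simp
      positivity
    · rw [one_div, inv_pow, inv_mul_eq_div, le_div_iff₀ (by positivity)]
      calc ‖x‖ ^ k * ‖iteratedFDeriv ℝ m D x‖ * 2 ^ J
          ≤ ‖x‖ ^ k * ‖iteratedFDeriv ℝ m D x‖ * ‖x‖ := by gcongr
        _ = ‖x‖ ^ (k + 1) * ‖iteratedFDeriv ℝ m D x‖ := by ring
        _ ≤ _ := (D.le_seminorm ℂ (k + 1) m x).trans hDS
  refine hbound.trans_eq ?_
  ring

/-- The Littlewood–Paley decomposition of a tempered distribution converges weakly. -/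
lemma IsResolution.tendsto_sum_block {θ : ℕ → 𝓢(Rn n, ℂ)} (hθ : IsResolution θ)
    (f : 𝓢'(Rn n, ℂ)) (φ : 𝓢(Rn n, ℂ)) :
    Tendsto (fun J => ∑ j ∈ Finset.range (J + 1), block θ j f φ) atTop (𝓝 (f φ)) := by
  have hcont : Continuous fun ψ : 𝓢(Rn n, ℂ) => f (𝓕 ψ) :=
    f.continuous.comp (fourierCLM ℂ 𝓢(Rn n, ℂ)).continuous
  have h := (hcont.tendsto _).comp (hθ.tendsto_sum_smul (𝓕⁻ φ))
  rw [FourierTransform.fourier_fourierInv_eq] at h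
  refine h.congr fun J => ?_
  have hsum := map_sum (f.toLinearMap ∘ₗ (fourierCLM ℂ 𝓢(Rn n, ℂ)).toLinearMap)
    (fun j => SchwartzMap.smulLeftCLM ℂ (θ j) (𝓕⁻ φ)) (Finset.range (J + 1))
  exact hsum

/-! ### Uniform continuity of bounded blocks -/

lemma tendsto_integral_norm_sub_translate (κ : 𝓢(Rn n, ℂ)) :
    Tendsto (fun h : Rn n => ∫ z, ‖κ z - κ (z + h)‖) (𝓝 0) (𝓝 0) := by
  obtain ⟨B, hB, hκ⟩ := exists_one_add_pow_mul_norm_le κ (n + 1)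
  have hκc := κ.continuous
  have hb : ∀ z, ‖κ z‖ ≤ B * ((1 + ‖z‖) ^ (n + 1))⁻¹ := fun z => by
    rw [← div_eq_mul_inv, le_div_iff₀ (by positivity), mul_comm]
    exact hκ z
  have hint : Integrable fun z : Rn n => ((1 + ‖z‖) ^ (n + 1))⁻¹ := by
    have := integrable_one_add_norm (E := Rn n) (μ := volume) (r := (n : ℝ) + 1) (by simp)
    refine this.congr (Eventually.of_forall fun z => ?_)
    simp only
    rw [Real.rpow_neg (by positivity), ← Nat.cast_add_one, Real.rpow_natCast]
  have h := tendsto_integral_filter_of_dominated_convergence (l := 𝓝 (0 : Rn n))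
    (F := fun h z => ‖κ z - κ (z + h)‖) (f := fun _ => (0 : ℝ)) (μ := volume)
    (fun z => (B + B * 2 ^ (n + 1)) * ((1 + ‖z‖) ^ (n + 1))⁻¹)
    (Eventually.of_forall fun h => by fun_prop) ?_ (hint.const_mul _)
    (Eventually.of_forall fun z => ?_)
  · simpa using h
  · filter_upwards [Metric.ball_mem_nhds (0 : Rn n) one_pos] with h hh
    refine Eventually.of_forall fun z => ?_
    rw [norm_norm]
    have hh' : ‖h‖ ≤ 1 := by simpa using (mem_ball_zero_iff.1 hh).le
    have hz : 1 + ‖z‖ ≤ 2 * (1 + ‖z + h‖) := by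
      have := norm_sub_le (z + h) h
      rw [add_sub_cancel_right] at this
      linarith [norm_nonneg (z + h)]
    have hinv : ((1 + ‖z + h‖) ^ (n + 1))⁻¹ ≤ 2 ^ (n + 1) * ((1 + ‖z‖) ^ (n + 1))⁻¹ := by
      rw [← div_eq_mul_inv, le_div_iff₀ (by positivity), inv_mul_le_iff₀ (by positivity),
        ← mul_pow, mul_comm]
      gcongr
    calc ‖κ z - κ (z + h)‖ ≤ ‖κ z‖ + ‖κ (z + h)‖ := norm_sub_le _ _
      _ ≤ B * ((1 + ‖z‖) ^ (n + 1))⁻¹ + B * (2 ^ (n + 1) * ((1 + ‖z‖) ^ (n + 1))⁻¹) := by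
          refine add_le_add (hb z) ((hb _).trans ?_)
          gcongr
      _ = _ := by ring
  · have hc : Continuous fun h => ‖κ z - κ (z + h)‖ := by fun_prop
    simpa using hc.tendsto 0

/-- Convolution with a Schwartz kernel maps bounded functions to uniformly continuous ones. -/
lemma uniformContinuous_of_ae_eq_convolution {g : Rn n → ℂ} (hg : Continuous g) {b : ℝ}
    (hb : ∀ x, ‖g x‖ ≤ b) (κ : 𝓢(Rn n, ℂ))
    (h : g =ᵐ[volume] fun x => ∫ y, κ (y - x) * g y) : UniformContinuous g := by
  have hb0 : 0 ≤ b := (norm_nonneg _).trans (hb 0)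
  have hκc := κ.continuous
  have hi : ∀ x, Integrable fun y => κ (y - x) * g y := fun x =>
    (κ.integrable.comp_sub_right x).mul_bdd hg.aestronglyMeasurable (Eventually.of_forall hb)
  have hdist : ∀ x x', ‖(∫ y, κ (y - x) * g y) - ∫ y, κ (y - x') * g y‖ ≤
      b * ∫ z, ‖κ z - κ (z + (x - x'))‖ := by
    intro x x'
    have hi' : Integrable fun y => b * ‖κ (y - x) - κ (y - x')‖ :=
      (((κ.integrable.comp_sub_right x).sub (κ.integrable.comp_sub_right x')).norm).const_mul b
    rw [← integral_sub (hi x) (hi x')]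
    calc _ ≤ ∫ y, b * ‖κ (y - x) - κ (y - x')‖ := by
          refine norm_integral_le_of_norm_le hi' (Eventually.of_forall fun y => ?_)
          rw [← sub_mul, norm_mul, mul_comm]
          gcongr
          exact hb y
      _ = b * ∫ y, ‖κ (y - x) - κ (y - x + (x - x'))‖ := by
          rw [integral_const_mul]
          simp only [sub_add_sub_cancel]
      _ = _ := by rw [integral_sub_right_eq_self (fun z => ‖κ z - κ (z + (x - x'))‖) x]
  have hG : UniformContinuous fun x => ∫ y, κ (y - x) * g y := by
    rw [Metric.uniformContinuous_iff]
    intro ε hε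
    have hlim := (tendsto_integral_norm_sub_translate κ).const_mul b
    rw [mul_zero] at hlim
    obtain ⟨δ, hδ, hball⟩ := Metric.eventually_nhds_iff.1 (hlim.eventually_lt_const hε)
    refine ⟨δ, hδ, fun x x' hx => ?_⟩
    rw [dist_eq_norm]
    refine (hdist x x').trans_lt (hball ?_)
    rwa [dist_zero_right, ← dist_eq_norm]
  rwa [(Continuous.ae_eq_iff_eq volume hg hG.continuous).1 h]

/-! ### The embedding of `B^0_{∞,1}` into `BUC` -/

lemma IsResolution.embedsIntoBUC {θ : ℕ → 𝓢(Rn n, ℂ)} (hθ : IsResolution θ) :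
    EmbedsIntoBUC (besovInftyOneNorm θ (fun _ => 0)) := by
  refine ⟨1, fun f hf => ?_⟩
  obtain ⟨g, hg⟩ := exists_isFunction_of_blockNorm_lt_top hf
  have hnorm : besovInftyOneNorm θ (fun _ => 0) f = ∑' j, essSup (fun x => ‖g j x‖ₑ) volume := by
    rw [besovInftyOneNorm, blockNorm_eq hg, seqNormOneInfty]
    simp
  rw [hnorm] at hf ⊢
  set b : ℕ → ℝ≥0∞ := fun j => essSup (fun x => ‖g j x‖ₑ) volume with hb
  have hbtop : ∀ j, b j ≠ ∞ := ENNReal.ne_top_of_tsum_ne_top hf.ne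
  have hbsum : Summable fun j => (b j).toReal := ENNReal.summable_toReal hf.ne
  have hgb : ∀ j x, ‖g j x‖ ≤ (b j).toReal := by
    intro j x
    have := le_of_ae_le_of_continuous (hg j).continuous.enorm continuous_const
      (ENNReal.ae_le_essSup (fun x => ‖g j x‖ₑ)) x
    rw [← toReal_enorm]
    exact ENNReal.toReal_mono (hbtop j) this
  obtain ⟨Ψ, hΨ⟩ := exists_schwartz_cutoff n
  have hguc : ∀ j, UniformContinuous (g j) := fun j =>
    uniformContinuous_of_ae_eq_convolution (hg j).continuous (hgb j) _ (hθ.block_ae_eq hΨ (hg j))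
  set G : Rn n → ℂ := fun x => ∑' j, g j x with hG
  have hGuc : UniformContinuous G := by
    refine (tendstoUniformly_tsum hbsum hgb).uniformContinuous
      (Eventually.frequently (Eventually.of_forall fun s => ?_))
    induction s using Finset.induction_on with
    | empty => simpa using uniformContinuous_const
    | insert j s hj ih =>
      simp only [Finset.sum_insert hj]
      exact (hguc j).add ih
  have hGsum : ∀ x, Summable fun j => g j x := fun x =>
    Summable.of_norm_bounded hbsum fun j => hgb j x
  have hGb : ∀ x, ‖G x‖ ≤ ∑' j, (b j).toReal := fun x =>
    tsum_of_norm_bounded hbsum.hasSum fun j => hgb j x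
  refine ⟨BoundedContinuousFunction.ofNormedAddCommGroup G hGuc.continuous _ hGb, hGuc,
    ⟨hGuc.continuous, ⟨∑' j, (b j).toReal, 0, by simpa using hGb⟩, fun φ => ?_⟩, ?_⟩
  · have hint : HasSum (fun j => ∫ x, φ x * g j x) (∫ x, φ x * G x) := by
      refine hasSum_integral_of_dominated_convergence
        (bound := fun j x => ‖φ x‖ * (b j).toReal)
        (fun j => ((hg j).integrable φ).aestronglyMeasurable)
        (fun j => Eventually.of_forall fun x => ?_)
        (Eventually.of_forall fun x => hbsum.mul_left _) ?_
        (Eventually.of_forall fun x => (hGsum x).hasSum.mul_left _)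
      · rw [norm_mul]
        gcongr
        exact hgb j x
      · simp only [tsum_mul_left]
        exact φ.integrable.norm.mul_const _
    refine tendsto_nhds_unique (hθ.tendsto_sum_block f φ) ?_
    simp only [(hg _).eq_integral φ]
    exact hint.tendsto_sum_nat.comp (tendsto_add_atTop_nat 1)
  · rw [ENNReal.coe_one, one_mul, ← ofReal_norm, ← ENNReal.ofReal_toReal hf.ne,
      ENNReal.tsum_toReal_eq hbtop]
    exact ENNReal.ofReal_le_ofReal
      (BoundedContinuousFunction.norm_ofNormedAddCommGroup_le _
        (tsum_nonneg fun _ => ENNReal.toReal_nonneg) hGb)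

lemma EmbedsIntoBUC.comp {N₁ N₂ : 𝓢'(Rn n, ℂ) → ℝ≥0∞} (h₂ : EmbedsIntoBUC N₂)
    (h₁ : Embeds N₁ N₂) : EmbedsIntoBUC N₁ := by
  obtain ⟨C₁, h₁⟩ := h₁
  obtain ⟨C₂, h₂⟩ := h₂
  refine ⟨C₂ * C₁, fun f hf => ?_⟩
  obtain ⟨g, hg, hfg, hle⟩ := h₂ f ((h₁ f hf).trans_lt (ENNReal.mul_lt_top (by simp) hf))
  refine ⟨g, hg, hfg, hle.trans ?_⟩
  rw [ENNReal.coe_mul, mul_assoc]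
  gcongr
  exact h₁ f hf

end VarExp

theorem proposition3p1p33 (n : ℕ) (hn : 0 < n) (p q s : VarExp.Rn n → ℝ)
    (hp : VarExp.IsExponent p) (hp_log : VarExp.IsLogHolder p)
    (hq : VarExp.IsExponent q) (hq_log : VarExp.IsLogHolder q)
    (hs_log : VarExp.IsLogHolder s)
    (θ : ℕ → 𝓢(VarExp.Rn n, ℂ)) (hθ : VarExp.IsResolution θ) :
    -- the Sobolev embeddings
    (VarExp.Embeds (VarExp.besovNorm θ s p q)
        (VarExp.besovInftyInftyNorm θ (fun x => s x - n / p x)) ∧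
      VarExp.Embeds (VarExp.triebelLizorkinNorm θ s p q)
        (VarExp.besovInftyInftyNorm θ (fun x => s x - n / p x))) ∧
    -- the embeddings into BUC through `B^0_{∞,1}`
    ((∃ ε : ℝ, 0 < ε ∧ ∀ᵐ x ∂volume, n / p x - s x ≤ -ε) →
      VarExp.Embeds (VarExp.besovNorm θ s p q) (VarExp.besovInftyOneNorm θ (fun _ => 0)) ∧
      VarExp.Embeds (VarExp.triebelLizorkinNorm θ s p q)
        (VarExp.besovInftyOneNorm θ (fun _ => 0)) ∧
      VarExp.EmbedsIntoBUC (VarExp.besovInftyOneNorm θ (fun _ => 0)) ∧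
      VarExp.EmbedsIntoBUC (VarExp.besovNorm θ s p q) ∧
      VarExp.EmbedsIntoBUC (VarExp.triebelLizorkinNorm θ s p q)) := by
  have hB := VarExp.controlsModulars_seqLpNorm hp hq
  have hF := VarExp.controlsModulars_lpSeqNorm hp hq
  refine ⟨⟨hθ.embeds_inftyInfty hp hp_log hs_log hB, hθ.embeds_inftyInfty hp hp_log hs_log hF⟩,
    fun ⟨ε, hε, hps⟩ => ?_⟩
  have hB₁ := hθ.embeds_inftyOne hp hp_log hs_log hB hε hps
  have hF₁ := hθ.embeds_inftyOne hp hp_log hs_log hF hε hps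
  exact ⟨hB₁, hF₁, hθ.embedsIntoBUC, hθ.embedsIntoBUC.comp hB₁, hθ.embedsIntoBUC.comp hF₁⟩
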